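/- A zero pattern of order $n$ is an $n\times n$ array $\mathcal A$ with entries in $\{\circledast,0\}$; $Q(\mathcal A)$ is the set of real $n\times n$ matrices $A$ such that $\mathcal A_{ij}=0$ implies $A_{ij}=0$. The $\circledast$ entries are called the nonzero entries of $\mathcal A$. The digraph of $\mathcal A$ has vertices $1,\dots,n$ and an arc $ij$ from $i$ to $j$ (a loop if $i=j$) for each $\mathcal A_{ij}=\circledast$. $\mathcal A$ is irreducible if no simultaneous permutation of rows and columns makes it block triangular with two or more non-empty diagonal blocks. Two patterns are equivalent if one is obtained from the other by permutation similarity and/or transposition. Counting eigenvalues with algebraic multiplicity, the inertia of a real matrix is $(n_+,n_-,n_0)$, the numbers of eigenvalues with positive, negative and zero real part, and its refined inertia is $(n_+,n_-,n_z,n_i)$, where $n_z$ is the number of zero eigenvalues and $n_i$ the number of nonzero purely imaginary eigenvalues. A pattern $\mathcal A$ of order $n$ is spectrally arbitrary if every monic real polynomial of degree $n$ is the characteristic polynomial of some $A\in Q(\mathcal A)$; inertially arbitrary if every triple of non-negative integers with sum $n$ is the inertia of some $A\in Q(\mathcal A)$; and refined inertially arbitrary if every quadruple $(n_1,n_2,n_3,n_4)$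 of non-negative integers with sum $n$ and $n_4$ even is the refined inertia of some $A\in Q(\mathcal A)$. The following patterns of order $4$ are given by the arc lists of their digraphs. * $\mathcal D_1$: 12, 21, 31, 41, 23, 34, 11; $\mathcal D_2$: 12, 21, 42, 41, 23, 34, 11; $\mathcal D_3$: 12, 21, 13, 41, 23, 34, 11; $\mathcal D_4$: 12, 21, 24, 41, 23, 34, 11; $\mathcal D_5$: 23, 32, 12, 31, 34, 41, 11; $\mathcal D_6$: 23, 32, 12, 34, 41, 42, 11; $\mathcal D_7$: 23, 32, 12, 34, 41, 13, 11; $\mathcal D_8$: 23, 32, 12, 34, 41, 24, 11. * $\mathcal Y_1$: 12, 21, 23, 34, 41, 11, 33; $\mathcal Y_2$: 12, 21, 23, 34, 41, 11, 44. * $\mathcal P_{4,1}$: 12, 21, 23, 32, 34, 43, 11; $\mathcal P_{4,2}$: 12, 21, 23, 32, 34, 43, 22. * $\mathcal R_1$: 11, 12, 21, 24, 42, 13, 34; $\mathcal R_2$: 11, 12, 21, 34, 43, 13, 32; $\mathcal R_3$: 11, 12, 21, 34, 43, 13, 42; $\mathcal R_4$: 11, 12, 21, 34, 43, 23, 42;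 $\mathcal R_5$: 11, 12, 21, 34, 43, 13, 41; $\mathcal R_6$: 11, 33, 12, 21, 23, 34, 42; $\mathcal R_7$: 11, 22, 34, 43, 12, 23, 41. * $\mathcal A_4$: 11, 22, 33, 12, 23, 34, 41. * $\mathcal B_1$: 11, 12, 21, 13, 32, 24, 41; $\mathcal B_2$: 11, 12, 21, 13, 32, 24, 43; $\mathcal B_3$: 11, 23, 32, 12, 24, 43, 31; $\mathcal B_4$: 11, 24, 42, 12, 23, 31, 34; $\mathcal B_5$: 11, 23, 32, 12, 31, 34, 42; $\mathcal B_6$: 11, 12, 21, 23, 32, 24, 43; $\mathcal B_7$: 11, 22, 12, 21, 13, 34, 41; $\mathcal B_8$: 11, 22, 34, 43, 12, 23, 31. * $\mathcal J_1$: 34, 41, 12, 23, 13, 11, 22; $\mathcal J_2$: 34, 41, 12, 23, 31, 11, 22; $\mathcal J_3$: 34, 41, 12, 23, 13, 11, 33; $\mathcal J_4$: 34, 41, 12, 23, 24, 11, 33; $\mathcal J_5$: 43, 41, 12, 32, 24, 11, 22; $\mathcal J_6$: 43, 41, 12, 32, 24, 11, 33. **Theorem.** Let $\mathcal A$ be an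 irreducible zero pattern of order $4$ with exactly $7$ nonzero entries. Then 1. $\mathcal A$ is spectrally arbitrary if and only if $\mathcal A$ is equivalent to one of $\mathcal D_1,\dots,\mathcal D_8,\mathcal Y_1,\mathcal Y_2$; 2. $\mathcal A$ is refined inertially arbitrary but not spectrally arbitrary if and only if $\mathcal A$ is equivalent to $\mathcal P_{4,1}$, $\mathcal P_{4,2}$ or one of $\mathcal R_1,\dots,\mathcal R_7$; 3. $\mathcal A$ is inertially arbitrary but not refined inertially arbitrary if and only if $\mathcal A$ is equivalent to $\mathcal A_4$, one of $\mathcal B_1,\dots,\mathcal B_8$ or one of $\mathcal J_1,\dots,\mathcal J_6$. -/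

import Mathlib

/-- A zero pattern of order `n`: an `n × n` array whose entries are `true` (the symbol `⊛`, an
unrestricted real entry) or `false` (the symbol `0`, an entry prescribed to be zero). It is also
the adjacency matrix of its digraph: `(i, j)` is an arc iff the `(i, j)` entry is `true`. -/
abbrev ZeroPattern (n : ℕ) := Matrix (Fin n) (Fin n) Bool

/-- The inertia `(n₊, n₋, n₀)` of a real matrix: the numbers of complex eigenvalues, counted with
algebraic multiplicity, with positive, negative and zero real part. -/
noncomputable def matrixInertia {n : ℕ} (A : Matrix (Fin n) (Fin n) ℝ) : ℕ × ℕ × ℕ :=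
  let ev : Multiset ℂ := (A.map ((↑) : ℝ → ℂ)).charpoly.roots
  (ev.countP (fun z => 0 < z.re), ev.countP (fun z => z.re < 0), ev.countP (fun z => z.re = 0))

/-- The refined inertia `(n₊, n₋, n_z, n_i)` of a real matrix: the numbers of complex eigenvalues,
counted with algebraic multiplicity, that have positive real part, have negative real part, are
zero, and are nonzero and purely imaginary. -/
noncomputable def matrixRefinedInertia {n : ℕ} (A : Matrix (Fin n) (Fin n) ℝ) :
    ℕ × ℕ × ℕ × ℕ :=
  let ev : Multiset ℂ := (A.map ((↑) : ℝ → ℂ)).charpoly.roots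
  (ev.countP (fun z => 0 < z.re), ev.countP (fun z => z.re < 0), ev.countP (fun z => z = 0),
    ev.countP (fun z => z.re = 0 ∧ z ≠ 0))

namespace ZeroPattern

/-- `Q(𝒜)`: the real matrices that vanish wherever the pattern prescribes a zero. -/
def qualitativeClass {n : ℕ} (𝒜 : ZeroPattern n) : Set (Matrix (Fin n) (Fin n) ℝ) :=
  {A | ∀ i j, 𝒜 i j = false → A i j = 0}

/-- Every monic real polynomial of degree `n` is the characteristic polynomial of a matrix in
`Q(𝒜)`. -/
def SpectrallyArbitrary {n : ℕ} (𝒜 : ZeroPattern n) : Prop :=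
  ∀ p : Polynomial ℝ, p.Monic → p.natDegree = n → ∃ A ∈ qualitativeClass 𝒜, A.charpoly = p

/-- Every triple of natural numbers with sum `n` is the inertia of a matrix in `Q(𝒜)`. -/
def InertiallyArbitrary {n : ℕ} (𝒜 : ZeroPattern n) : Prop :=
  ∀ n₁ n₂ n₃ : ℕ, n₁ + n₂ + n₃ = n →
    ∃ A ∈ qualitativeClass 𝒜, matrixInertia A = (n₁, n₂, n₃)

/-- Every refined inertia `(n₁, n₂, n₃, n₄)` with sum `n` is the refined inertia of a matrix in
`Q(𝒜)`. The number `n₄` is even, since the nonreal eigenvalues of a real matrix come in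
conjugate pairs. -/
def RefinedInertiallyArbitrary {n : ℕ} (𝒜 : ZeroPattern n) : Prop :=
  ∀ n₁ n₂ n₃ n₄ : ℕ, n₁ + n₂ + n₃ + n₄ = n → Even n₄ →
    ∃ A ∈ qualitativeClass 𝒜, matrixRefinedInertia A = (n₁, n₂, n₃, n₄)

/-- No simultaneous permutation of rows and columns brings the pattern to block (upper)
triangular form with two non-empty diagonal blocks, of orders `k` and `n - k`. -/
def IsIrreducible {n : ℕ} (𝒜 : ZeroPattern n) : Prop :=
  ¬ ∃ (σ : Equiv.Perm (Fin n)) (k : ℕ), 0 < k ∧ k < n ∧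
    ∀ i j : Fin n, k ≤ (i : ℕ) → (j : ℕ) < k → 𝒜 (σ i) (σ j) = false

/-- The number of `⊛` entries. -/
def numNonzero {n : ℕ} (𝒜 : ZeroPattern n) : ℕ :=
  (Finset.univ.filter (fun p : Fin n × Fin n => 𝒜 p.1 p.2 = true)).card

/-- `ℬ` is obtained from `𝒜` by permutation similarity and/or transposition. -/
def Equivalent {n : ℕ} (𝒜 ℬ : ZeroPattern n) : Prop :=
  ∃ σ : Equiv.Perm (Fin n),
    (∀ i j, ℬ i j = 𝒜 (σ i) (σ j)) ∨ (∀ i j, ℬ i j = 𝒜 (σ j) (σ i))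

/-- The pattern of the digraph on the vertices `1, …, n` with the listed arcs; a loop at `v` is
the arc `(v, v)`. -/
def ofArcs (n : ℕ) (arcs : List (ℕ × ℕ)) : ZeroPattern n :=
  Matrix.of fun i j => decide (((i : ℕ) + 1, (j : ℕ) + 1) ∈ arcs)

/-- `𝒫_{n,α}`, with `1 ≤ α ≤ n`: `⊛` exactly on the superdiagonal, on the subdiagonal, and in the
diagonal position of row `α` (rows are numbered from `1`). -/
def pathPattern (n α : ℕ) : ZeroPattern n :=
  Matrix.of fun i j =>
    decide ((i : ℕ) + 1 = j ∨ (j : ℕ) + 1 = i ∨ (i = j ∧ (i : ℕ) + 1 = α))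

/-- `𝒜_n`: `⊛` exactly on the superdiagonal, in the first `n - 1` diagonal positions, and in the
bottom left corner. -/
def cyclePattern (n : ℕ) : ZeroPattern n :=
  Matrix.of fun i j =>
    decide ((i : ℕ) + 1 = j ∨ (i = j ∧ (i : ℕ) + 1 < n) ∨ ((i : ℕ) + 1 = n ∧ (j : ℕ) = 0))

/-- The eight digraphs of the patterns of order `4` in the class `𝒞₄`: exactly one `k`-cycle for
each `k ≤ 4`, and a Hamilton path such that each proper cycle has exactly one arc outside it. -/
def classCFour : List (ZeroPattern 4) :=
  [ofArcs 4 [(1, 2), (2, 1), (3, 1), (4, 1), (2, 3), (3, 4), (1, 1)],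
   ofArcs 4 [(1, 2), (2, 1), (4, 2), (4, 1), (2, 3), (3, 4), (1, 1)],
   ofArcs 4 [(1, 2), (2, 1), (1, 3), (4, 1), (2, 3), (3, 4), (1, 1)],
   ofArcs 4 [(1, 2), (2, 1), (2, 4), (4, 1), (2, 3), (3, 4), (1, 1)],
   ofArcs 4 [(2, 3), (3, 2), (1, 2), (3, 1), (3, 4), (4, 1), (1, 1)],
   ofArcs 4 [(2, 3), (3, 2), (1, 2), (3, 4), (4, 1), (4, 2), (1, 1)],
   ofArcs 4 [(2, 3), (3, 2), (1, 2), (3, 4), (4, 1), (1, 3), (1, 1)],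
   ofArcs 4 [(2, 3), (3, 2), (1, 2), (3, 4), (4, 1), (2, 4), (1, 1)]]

/-- The digraph of `𝒴₄(3,1)` and the related spectrally arbitrary digraph: a `4`-cycle, one
`2`-cycle on an arc of it, and two loops. -/
def classYFour : List (ZeroPattern 4) :=
  [ofArcs 4 [(1, 2), (2, 1), (2, 3), (3, 4), (4, 1), (1, 1), (3, 3)],
   ofArcs 4 [(1, 2), (2, 1), (2, 3), (3, 4), (4, 1), (1, 1), (4, 4)]]

/-- The patterns `ℛ₁, …, ℛ₇`. -/
def tableR : List (ZeroPattern 4) :=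
  [ofArcs 4 [(1, 1), (1, 2), (2, 1), (2, 4), (4, 2), (1, 3), (3, 4)],
   ofArcs 4 [(1, 1), (1, 2), (2, 1), (3, 4), (4, 3), (1, 3), (3, 2)],
   ofArcs 4 [(1, 1), (1, 2), (2, 1), (3, 4), (4, 3), (1, 3), (4, 2)],
   ofArcs 4 [(1, 1), (1, 2), (2, 1), (3, 4), (4, 3), (2, 3), (4, 2)],
   ofArcs 4 [(1, 1), (1, 2), (2, 1), (3, 4), (4, 3), (1, 3), (4, 1)],
   ofArcs 4 [(1, 1), (3, 3), (1, 2), (2, 1), (2, 3), (3, 4), (4, 2)],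
   ofArcs 4 [(1, 1), (2, 2), (3, 4), (4, 3), (1, 2), (2, 3), (4, 1)]]

/-- The patterns `ℬ₁, …, ℬ₈`. -/
def tableB : List (ZeroPattern 4) :=
  [ofArcs 4 [(1, 1), (1, 2), (2, 1), (1, 3), (3, 2), (2, 4), (4, 1)],
   ofArcs 4 [(1, 1), (1, 2), (2, 1), (1, 3), (3, 2), (2, 4), (4, 3)],
   ofArcs 4 [(1, 1), (2, 3), (3, 2), (1, 2), (2, 4), (4, 3), (3, 1)],
   ofArcs 4 [(1, 1), (2, 4), (4, 2), (1, 2), (2, 3), (3, 1), (3, 4)],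
   ofArcs 4 [(1, 1), (2, 3), (3, 2), (1, 2), (3, 1), (3, 4), (4, 2)],
   ofArcs 4 [(1, 1), (1, 2), (2, 1), (2, 3), (3, 2), (2, 4), (4, 3)],
   ofArcs 4 [(1, 1), (2, 2), (1, 2), (2, 1), (1, 3), (3, 4), (4, 1)],
   ofArcs 4 [(1, 1), (2, 2), (3, 4), (4, 3), (1, 2), (2, 3), (3, 1)]]

/-- The patterns `𝒥₁, …, 𝒥₆` without a proper `2`-cycle. -/
def tableJ : List (ZeroPattern 4) :=
  [ofArcs 4 [(3, 4), (4, 1), (1, 2), (2, 3), (1, 3), (1, 1), (2, 2)],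
   ofArcs 4 [(3, 4), (4, 1), (1, 2), (2, 3), (3, 1), (1, 1), (2, 2)],
   ofArcs 4 [(3, 4), (4, 1), (1, 2), (2, 3), (1, 3), (1, 1), (3, 3)],
   ofArcs 4 [(3, 4), (4, 1), (1, 2), (2, 3), (2, 4), (1, 1), (3, 3)],
   ofArcs 4 [(4, 3), (4, 1), (1, 2), (3, 2), (2, 4), (1, 1), (2, 2)],
   ofArcs 4 [(4, 3), (4, 1), (1, 2), (3, 2), (2, 4), (1, 1), (3, 3)]]

end ZeroPattern

/-!
For a real matrix of order `4` the characteristic polynomial is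
`X ^ 4 - e₁ X ^ 3 + e₂ X ^ 2 - e₃ X + e₄`, where `e_k` is the sum of the principal minors of order
`k` (`charpoly_fin_four`). Membership of such a quartic in the set of characteristic polynomials of
a pattern is therefore a system of four polynomial equations in the nonzero entries
(`quartic_mem_iff`), and the set is invariant under equivalence (`Equivalent.charpolySet_eq`).

*Reduction to a finite list.* An inertially arbitrary pattern has a matrix whose eigenvalues all
have positive real part, and then all `e_k` are positive. Hence the digraph has, for each
`k ≤ 4`, a set of disjoint cycles covering exactly `k` vertices. The irreducible patterns with seven
arcs and this property are, up to equivalence, the thirty-four listed ones and one more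
(`classification`). The extra pattern satisfies `e₃ = e₁ e₂` identically, which excludes a spectrum
in the open right half-plane.

*The listed patterns.* For `𝒟` and `𝒴` the system is solvable for all `e₁, …, e₄`; for `𝒴` a real
root of a cubic is needed. For `ℛ` and `𝒫` some quartic is missed, and for `𝒜₄`, `ℬ`, `𝒥` no
quartic with roots `± i s`, `± i t` (`s, t > 0`) is attained, so that the refined inertia
`(0, 0, 0, 4)` is missed. For the positive assertions, the sets of attained quartics contain all
quartics satisfying the explicit conditions collected in `RefinedAdmissible` and
`InertialAdmissible` respectively. Thirteen products of two quadratics, together with their images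
under negation and the zero spectrum, represent all refined inertias, and these products satisfy
the conditions simultaneously. The refined inertia of a product of real quadratics is read off from
the signs of the coefficients (`polyRefinedInertia_quad`).
-/

namespace ZeroPattern

open Polynomial

/-! ### Refined inertia of a real polynomial -/

/-- The refined inertia of a real polynomial: the numbers of complex roots, counted with
multiplicity, that have positive real part, have negative real part, are zero, and are nonzero and
purely imaginary. -/
noncomputable def polyRefinedInertia (p : ℝ[X]) : ℕ × ℕ × ℕ × ℕ :=
  let ev : Multiset ℂ := (p.map Complex.ofRealHom).roots
  (ev.countP (fun z => 0 < z.re), ev.countP (fun z => z.re < 0), ev.countP (fun z => z = 0),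
    ev.countP (fun z => z.re = 0 ∧ z ≠ 0))

theorem matrixRefinedInertia_eq {n : ℕ} (A : Matrix (Fin n) (Fin n) ℝ) :
    matrixRefinedInertia A = polyRefinedInertia A.charpoly := by
  have h : (A.map ((↑) : ℝ → ℂ)).charpoly = A.charpoly.map Complex.ofRealHom :=
    Matrix.charpoly_map A Complex.ofRealHom
  unfold matrixRefinedInertia polyRefinedInertia
  rw [h]

/-- The inertia is a function of the refined inertia. -/
theorem matrixInertia_eq {n : ℕ} (A : Matrix (Fin n) (Fin n) ℝ) :
    matrixInertia A = ((matrixRefinedInertia A).1, (matrixRefinedInertia A).2.1,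
      (matrixRefinedInertia A).2.2.1 + (matrixRefinedInertia A).2.2.2) := by
  unfold matrixInertia matrixRefinedInertia
  simp only [Prod.mk.injEq, true_and]
  generalize (A.map ((↑) : ℝ → ℂ)).charpoly.roots = s
  induction s using Multiset.induction_on with
  | empty => simp
  | cons z s ih =>
    simp only [Multiset.countP_cons, ih]
    by_cases h0 : z = 0
    · subst h0; simp; omega
    · by_cases hr : z.re = 0 <;> simp [h0, hr]; omega

theorem polyRefinedInertia_mul {p q : ℝ[X]} (hp : p.Monic) (hq : q.Monic) :
    polyRefinedInertia (p * q) = polyRefinedInertia p + polyRefinedInertia q := by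
  have h : (p.map Complex.ofRealHom * q.map Complex.ofRealHom) ≠ 0 :=
    ((hp.map _).mul (hq.map _)).ne_zero
  simp [polyRefinedInertia, Polynomial.map_mul, roots_mul h, Multiset.countP_add]

/-- The monic quadratic whose roots have sum `a` and product `b`. -/
noncomputable def quad (a b : ℝ) : ℝ[X] := X ^ 2 - C a * X + C b

theorem quad_monic (a b : ℝ) : (quad a b).Monic := by
  unfold quad; monicity!

/-- The refined inertia of `quad a b`, read off from the signs of `a` and `b`. -/
noncomputable def quadRefinedInertia (a b : ℝ) : ℕ × ℕ × ℕ × ℕ :=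
  if 0 < b then (if 0 < a then (2, 0, 0, 0) else if a < 0 then (0, 2, 0, 0) else (0, 0, 0, 2))
  else if b < 0 then (1, 1, 0, 0)
  else (if 0 < a then (1, 0, 1, 0) else if a < 0 then (0, 1, 1, 0) else (0, 0, 2, 0))

theorem exists_roots_quad (a b : ℝ) : ∃ x y : ℂ,
    ((quad a b).map Complex.ofRealHom).roots = {x, y} ∧ x + y = a ∧ x * y = b := by
  have hm := (quad_monic a b).map Complex.ofRealHom
  have hd : ((quad a b).map Complex.ofRealHom).natDegree = 2 := by
    rw [(quad_monic a b).natDegree_map]; unfold quad; compute_degree!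
  have hc : ((quad a b).map Complex.ofRealHom).roots.card = 2 := by
    rw [← hd]; exact ((IsAlgClosed.splits _).natDegree_eq_card_roots).symm
  obtain ⟨x, y, hxy⟩ := Multiset.card_eq_two.1 hc
  have he : (quad a b).map Complex.ofRealHom =
      C (1 : ℂ) * X ^ 2 + C (-(a : ℂ)) * X + C (b : ℂ) := by
    simp [quad]; ring
  have hv := (roots_quadratic_eq_pair_iff_of_ne_zero (one_ne_zero (α := ℂ))).1 (he ▸ hxy)
  exact ⟨x, y, hxy, by linear_combination hv.1, by linear_combination -hv.2⟩

/-- The real and imaginary parts of the two roots of a real quadratic, which are real or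
have the same real part. -/
theorem exists_roots_quad_parts (a b : ℝ) : ∃ x y : ℂ,
    ((quad a b).map Complex.ofRealHom).roots = {x, y} ∧ x.re + y.re = a ∧ y.im = - x.im ∧
      x.re * y.re + x.im ^ 2 = b ∧ (x.im = 0 ∨ x.re = y.re) := by
  obtain ⟨x, y, hr, hs, hp⟩ := exists_roots_quad a b
  have h1 := congrArg Complex.re hs
  have h2 := congrArg Complex.im hs
  have h3 := congrArg Complex.re hp
  have h4 := congrArg Complex.im hp
  simp only [Complex.add_re, Complex.add_im, Complex.mul_re, Complex.mul_im, Complex.ofReal_re,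
    Complex.ofReal_im] at h1 h2 h3 h4
  have h5 : y.im = - x.im := by linarith
  rw [h5] at h3 h4
  refine ⟨x, y, hr, h1, h5, by linarith, ?_⟩
  have h6 : x.im * (x.re - y.re) = 0 := by linarith
  rcases mul_eq_zero.1 h6 with h | h
  · exact Or.inl h
  · exact Or.inr (by linarith)

theorem polyRefinedInertia_pair {p : ℝ[X]} {x y : ℂ}
    (h : (p.map Complex.ofRealHom).roots = {x, y}) :
    polyRefinedInertia p =
      ((if 0 < x.re then 1 else 0) + (if 0 < y.re then 1 else 0),
        (if x.re < 0 then 1 else 0) + (if y.re < 0 then 1 else 0),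
        (if x = 0 then 1 else 0) + (if y = 0 then 1 else 0),
        (if x.re = 0 ∧ x ≠ 0 then 1 else 0) + (if y.re = 0 ∧ y ≠ 0 then 1 else 0)) := by
  have h' : ({x, y} : Multiset ℂ) = x ::ₘ y ::ₘ 0 := rfl
  simp only [polyRefinedInertia, h, h', Multiset.countP_cons, Multiset.countP_zero, zero_add,
    Prod.mk.injEq]
  refine ⟨add_comm _ _, add_comm _ _, add_comm _ _, add_comm _ _⟩

theorem polyRefinedInertia_quad (a b : ℝ) :
    polyRefinedInertia (quad a b) = quadRefinedInertia a b := by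
  obtain ⟨x, y, hr, hs, hi, hp, hc⟩ := exists_roots_quad_parts a b
  rw [polyRefinedInertia_pair hr]
  obtain ⟨x1, x2⟩ := x
  obtain ⟨y1, y2⟩ := y
  simp only [Complex.ext_iff, Complex.zero_re, Complex.zero_im, ne_eq] at *
  subst hi hs hp
  unfold quadRefinedInertia
  rcases hc with rfl | rfl
  · rcases lt_trichotomy x1 0 with h1 | rfl | h1 <;>
    rcases lt_trichotomy y1 0 with h2 | rfl | h2 <;>
    simp [*, mul_pos_of_neg_of_neg, mul_neg_of_neg_of_pos, mul_neg_of_pos_of_neg,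
      not_lt_of_gt, ne_of_gt, ne_of_lt]
    · rw [if_neg (by linarith), if_pos (by linarith)]
    · intro h; linarith
  · by_cases h : x2 = 0
    · rcases lt_trichotomy x1 0 with h1 | rfl | h1 <;>
        simp [*, not_lt_of_gt, ne_of_gt, ne_of_lt]
    · have h' : 0 < x1 * x1 + x2 ^ 2 := by nlinarith [sq_nonneg x1, sq_pos_of_ne_zero h]
      rcases lt_trichotomy x1 0 with h1 | rfl | h1 <;>
        simp [*, not_lt_of_gt, ne_of_gt, ne_of_lt]

/-- Every monic real quartic is a product of two real monic quadratics. -/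
theorem exists_eq_quad_mul_quad {p : ℝ[X]} (hp : p.Monic) (hd : p.natDegree = 4) :
    ∃ a b c d : ℝ, p = quad a b * quad c d := by
  have key : ∀ f : ℝ[X], IsMonicOfDegree f 2 → ∃ a b, f = quad a b := by
    intro f hf
    have h2 : f.coeff 2 = 1 := by
      have := hf.monic.coeff_natDegree
      rwa [hf.natDegree_eq] at this
    refine ⟨-f.coeff 1, f.coeff 0, ?_⟩
    conv_lhs => rw [eq_quadratic_of_degree_le_two (natDegree_le_iff_degree_le.1 hf.natDegree_eq.le)]
    simp [quad, h2]
  obtain ⟨f, g, hf, hg, rfl⟩ :=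
    IsMonicOfDegree.eq_isMonicOfDegree_two_mul_isMonicOfDegree (n := 2) ⟨hd, hp⟩
  obtain ⟨a, b, rfl⟩ := key f hf
  obtain ⟨c, d, rfl⟩ := key g hg
  exact ⟨a, b, c, d, rfl⟩

/-- The monic quartic whose roots have elementary symmetric functions `e₁, e₂, e₃, e₄`. -/
noncomputable def quartic (e₁ e₂ e₃ e₄ : ℝ) : ℝ[X] :=
  X ^ 4 - C e₁ * X ^ 3 + C e₂ * X ^ 2 - C e₃ * X + C e₄

theorem quad_mul_quad (a b c d : ℝ) :
    quad a b * quad c d = quartic (a + c) (b + d + a * c) (a * d + b * c) (b * d) := by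
  simp only [quad, quartic, map_add, map_mul]
  ring

theorem quartic_inj {e₁ e₂ e₃ e₄ f₁ f₂ f₃ f₄ : ℝ}
    (h : quartic e₁ e₂ e₃ e₄ = quartic f₁ f₂ f₃ f₄) : e₁ = f₁ ∧ e₂ = f₂ ∧ e₃ = f₃ ∧ e₄ = f₄ := by
  have h0 := congrArg (coeff · 0) h
  have h1 := congrArg (coeff · 1) h
  have h2 := congrArg (coeff · 2) h
  have h3 := congrArg (coeff · 3) h
  simp [quartic, coeff_X, coeff_C] at h0 h1 h2 h3
  exact ⟨h3, h2, h1, h0⟩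

theorem exists_eq_quartic {p : ℝ[X]} (hp : p.Monic) (hd : p.natDegree = 4) :
    ∃ e₁ e₂ e₃ e₄, p = quartic e₁ e₂ e₃ e₄ := by
  obtain ⟨a, b, c, d, rfl⟩ := exists_eq_quad_mul_quad hp hd
  exact ⟨_, _, _, _, quad_mul_quad a b c d⟩

theorem quartic_monic (e₁ e₂ e₃ e₄ : ℝ) : (quartic e₁ e₂ e₃ e₄).Monic := by
  unfold quartic; monicity!

theorem quartic_natDegree (e₁ e₂ e₃ e₄ : ℝ) : (quartic e₁ e₂ e₃ e₄).natDegree = 4 := by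
  unfold quartic; compute_degree!

theorem det_fin_four {R : Type*} [CommRing R] (A : Matrix (Fin 4) (Fin 4) R) :
    A.det =
      A 0 0 * (A 1 1 * (A 2 2 * A 3 3 - A 2 3 * A 3 2) - A 1 2 * (A 2 1 * A 3 3 - A 2 3 * A 3 1) +
        A 1 3 * (A 2 1 * A 3 2 - A 2 2 * A 3 1)) -
      A 0 1 * (A 1 0 * (A 2 2 * A 3 3 - A 2 3 * A 3 2) - A 1 2 * (A 2 0 * A 3 3 - A 2 3 * A 3 0) +
        A 1 3 * (A 2 0 * A 3 2 - A 2 2 * A 3 0)) +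
      A 0 2 * (A 1 0 * (A 2 1 * A 3 3 - A 2 3 * A 3 1) - A 1 1 * (A 2 0 * A 3 3 - A 2 3 * A 3 0) +
        A 1 3 * (A 2 0 * A 3 1 - A 2 1 * A 3 0)) -
      A 0 3 * (A 1 0 * (A 2 1 * A 3 2 - A 2 2 * A 3 1) - A 1 1 * (A 2 0 * A 3 2 - A 2 2 * A 3 0) +
        A 1 2 * (A 2 0 * A 3 1 - A 2 1 * A 3 0)) := by
  have h4 : (Fin.succ 1 : Fin 4) = 2 := rfl
  have h5 : (Fin.succ 2 : Fin 4) = 3 := rfl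
  simp [Matrix.det_succ_row_zero A, Matrix.det_fin_three, Fin.sum_univ_succ, Fin.succAbove, h4, h5]
  ring

/-- The coefficients of the characteristic polynomial as signed sums of principal minors. -/
theorem charpoly_fin_four (A : Matrix (Fin 4) (Fin 4) ℝ) :
    A.charpoly = quartic (A 0 0 + A 1 1 + A 2 2 + A 3 3)
      ((A.submatrix ![0, 1] ![0, 1]).det + (A.submatrix ![0, 2] ![0, 2]).det +
        (A.submatrix ![0, 3] ![0, 3]).det + (A.submatrix ![1, 2] ![1, 2]).det +
        (A.submatrix ![1, 3] ![1, 3]).det + (A.submatrix ![2, 3] ![2, 3]).det)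
      ((A.submatrix ![0, 1, 2] ![0, 1, 2]).det + (A.submatrix ![0, 1, 3] ![0, 1, 3]).det +
        (A.submatrix ![0, 2, 3] ![0, 2, 3]).det + (A.submatrix ![1, 2, 3] ![1, 2, 3]).det)
      A.det := by
  simp only [Matrix.det_fin_three, Matrix.det_fin_two, Matrix.submatrix_apply, det_fin_four,
    Matrix.charpoly, Matrix.charmatrix_apply, Matrix.diagonal_apply]
  simp [quartic]
  ring

/-! ### Characteristic polynomials attained by a pattern -/

/-- The characteristic polynomials of the matrices in `Q(𝒜)`. -/
def charpolySet {n : ℕ} (𝒜 : ZeroPattern n) : Set ℝ[X] :=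
  {p | ∃ A ∈ qualitativeClass 𝒜, A.charpoly = p}

theorem Equivalent.charpolySet_eq {n : ℕ} {𝒜 ℬ : ZeroPattern n} (h : Equivalent 𝒜 ℬ) :
    charpolySet 𝒜 = charpolySet ℬ := by
  obtain ⟨σ, h | h⟩ := h
  · ext p
    constructor
    · rintro ⟨A, hA, rfl⟩
      refine ⟨A.submatrix σ σ, fun i j hij => hA _ _ ((h i j).symm.trans hij), ?_⟩
      simpa using Matrix.charpoly_reindex σ.symm A
    · rintro ⟨B, hB, rfl⟩
      refine ⟨B.submatrix σ.symm σ.symm, fun i j hij => hB _ _ ?_, ?_⟩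
      · rw [h]; simpa using hij
      · simpa using Matrix.charpoly_reindex σ B
  · ext p
    constructor
    · rintro ⟨A, hA, rfl⟩
      refine ⟨(A.submatrix σ σ).transpose, fun i j hij => hA _ _ ((h i j).symm.trans hij), ?_⟩
      rw [Matrix.charpoly_transpose]
      simpa using Matrix.charpoly_reindex σ.symm A
    · rintro ⟨B, hB, rfl⟩
      refine ⟨(B.submatrix σ.symm σ.symm).transpose, fun i j hij => hB _ _ ?_, ?_⟩
      · rw [h]; simpa using hij
      · rw [Matrix.charpoly_transpose]
        simpa using Matrix.charpoly_reindex σ B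

/-- The principal minor of `A` on the rows and columns `i, j, k`. -/
def minor₃ (A : Matrix (Fin 4) (Fin 4) ℝ) (i j k : Fin 4) : ℝ :=
  A i i * (A j j * A k k - A j k * A k j) - A i j * (A j i * A k k - A j k * A k i) +
    A i k * (A j i * A k j - A j j * A k i)

/-- Membership of a quartic in `charpolySet` as four polynomial equations in the entries. -/
theorem quartic_mem_iff {𝒜 : ZeroPattern 4} {e₁ e₂ e₃ e₄ : ℝ} :
    quartic e₁ e₂ e₃ e₄ ∈ charpolySet 𝒜 ↔ ∃ A ∈ qualitativeClass 𝒜,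
      A 0 0 + A 1 1 + A 2 2 + A 3 3 = e₁ ∧
      (A 0 0 * A 1 1 - A 0 1 * A 1 0) + (A 0 0 * A 2 2 - A 0 2 * A 2 0) +
        (A 0 0 * A 3 3 - A 0 3 * A 3 0) + (A 1 1 * A 2 2 - A 1 2 * A 2 1) +
        (A 1 1 * A 3 3 - A 1 3 * A 3 1) + (A 2 2 * A 3 3 - A 2 3 * A 3 2) = e₂ ∧
      minor₃ A 0 1 2 + minor₃ A 0 1 3 + minor₃ A 0 2 3 + minor₃ A 1 2 3 = e₃ ∧
      A.det = e₄ := by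
  have hm : ∀ (A : Matrix (Fin 4) (Fin 4) ℝ) (i j k : Fin 4),
      (A.submatrix ![i, j, k] ![i, j, k]).det = minor₃ A i j k := by
    intro A i j k
    simp only [Matrix.det_fin_three, Matrix.submatrix_apply, minor₃]
    simp
    ring
  have key : ∀ A : Matrix (Fin 4) (Fin 4) ℝ, _ := fun A => charpoly_fin_four A
  simp only [hm, Matrix.det_fin_two, Matrix.submatrix_apply] at key
  constructor
  · rintro ⟨A, hA, h⟩
    exact ⟨A, hA, quartic_inj ((key A).symm.trans h)⟩
  · rintro ⟨A, hA, h1, h2, h3, h4⟩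
    refine ⟨A, hA, (key A).trans ?_⟩
    rw [← h1, ← h2, ← h3, ← h4]
    rfl

theorem neg_quartic_mem {𝒜 : ZeroPattern 4} {e₁ e₂ e₃ e₄ : ℝ}
    (h : quartic e₁ e₂ e₃ e₄ ∈ charpolySet 𝒜) : quartic (-e₁) e₂ (-e₃) e₄ ∈ charpolySet 𝒜 := by
  obtain ⟨A, hA, h1, h2, h3, h4⟩ := quartic_mem_iff.1 h
  refine quartic_mem_iff.2 ⟨-A, fun i j hij => by simp [hA i j hij], ?_, ?_, ?_, ?_⟩
  · simp only [Matrix.neg_apply]; linarith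
  · simp only [Matrix.neg_apply]; linarith
  · rw [← h3]; simp only [minor₃, Matrix.neg_apply]; ring
  · rw [← h4, Matrix.det_neg, Fintype.card_fin]; ring

theorem zero_quartic_mem (𝒜 : ZeroPattern 4) : quartic 0 0 0 0 ∈ charpolySet 𝒜 :=
  ⟨0, fun _ _ _ => rfl, by simp [quartic]⟩

theorem RefinedInertiallyArbitrary.inertiallyArbitrary {n : ℕ} {𝒜 : ZeroPattern n}
    (h : RefinedInertiallyArbitrary 𝒜) : InertiallyArbitrary 𝒜 := by
  intro n₁ n₂ n₃ hn
  obtain ⟨A, hA, hr⟩ := h n₁ n₂ n₃ 0 (by omega) (by simp)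
  exact ⟨A, hA, by rw [matrixInertia_eq, hr]; rfl⟩

theorem polyRefinedInertia_quad_mul_quad (a b c d : ℝ) :
    polyRefinedInertia (quad a b * quad c d) = quadRefinedInertia a b + quadRefinedInertia c d := by
  rw [polyRefinedInertia_mul (quad_monic _ _) (quad_monic _ _), polyRefinedInertia_quad,
    polyRefinedInertia_quad]

/-- The product of the quadratics with root sums `a`, `c` and root products `b`, `d` is attained
by the pattern. -/
def AttainsQuads (𝒜 : ZeroPattern 4) (a b c d : ℝ) : Prop :=
  quartic (a + c) (b + d + a * c) (a * d + b * c) (b * d) ∈ charpolySet 𝒜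

theorem AttainsQuads.neg {𝒜 : ZeroPattern 4} {a b c d : ℝ} (h : AttainsQuads 𝒜 a b c d) :
    AttainsQuads 𝒜 (-a) b (-c) d := by
  have := neg_quartic_mem h
  unfold AttainsQuads
  convert this using 2 <;> ring

theorem AttainsQuads.exists_refinedInertia {𝒜 : ZeroPattern 4} {a b c d : ℝ}
    (h : AttainsQuads 𝒜 a b c d) {r : ℕ × ℕ × ℕ × ℕ}
    (hr : quadRefinedInertia a b + quadRefinedInertia c d = r) :
    ∃ A ∈ qualitativeClass 𝒜, matrixRefinedInertia A = r := by
  obtain ⟨A, hA, hp⟩ := h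
  refine ⟨A, hA, ?_⟩
  rw [matrixRefinedInertia_eq, hp, ← quad_mul_quad, polyRefinedInertia_quad_mul_quad, hr]

/-- Eight spectra without nonzero purely imaginary eigenvalues that, up to negation and together
with the zero spectrum, represent all inertias. The digits of a field name are the inertia. -/
structure AttainsRealWitnesses (𝒜 : ZeroPattern 4) : Prop where
  w400 : AttainsQuads 𝒜 53 50 25 44
  w310 : AttainsQuads 𝒜 11 3 4 (-28)
  w220 : AttainsQuads 𝒜 (-1) (-4) 7 (-10)
  w301 : AttainsQuads 𝒜 4 1 1 0
  w211 : AttainsQuads 𝒜 0 (-1) 1 0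
  w202 : AttainsQuads 𝒜 3 2 0 0
  w112 : AttainsQuads 𝒜 0 (-1) 0 0
  w103 : AttainsQuads 𝒜 1 0 0 0

/-- Five spectra with nonzero purely imaginary eigenvalues that, up to negation, represent all
refined inertias with `n_i > 0`. The digits of a field name are the refined inertia. -/
structure AttainsImaginaryWitnesses (𝒜 : ZeroPattern 4) : Prop where
  w2002 : AttainsQuads 𝒜 2 1 0 1
  w1102 : AttainsQuads 𝒜 (-2) (-9) 0 1
  w1012 : AttainsQuads 𝒜 1 0 0 1
  w0022 : AttainsQuads 𝒜 0 0 0 1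
  w0004 : AttainsQuads 𝒜 0 2 0 3

theorem AttainsRealWitnesses.exists_refinedInertia {𝒜 : ZeroPattern 4}
    (h : AttainsRealWitnesses 𝒜) {n₁ n₂ n₃ : ℕ} (hn : n₁ + n₂ + n₃ = 4) :
    ∃ A ∈ qualitativeClass 𝒜, matrixRefinedInertia A = (n₁, n₂, n₃, 0) := by
  have hz : AttainsQuads 𝒜 0 0 0 0 := by
    simpa [AttainsQuads] using zero_quartic_mem 𝒜
  obtain ⟨h400, h310, h220, h301, h211, h202, h112, h103⟩ := h
  obtain rfl : n₃ = 4 - n₁ - n₂ := by omega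
  have h1 : n₁ ≤ 4 := by omega
  have h2 : n₂ ≤ 4 - n₁ := by omega
  interval_cases n₁ <;> interval_cases n₂
  · exact hz.exists_refinedInertia (by norm_num [quadRefinedInertia])
  · exact h103.neg.exists_refinedInertia (by norm_num [quadRefinedInertia])
  · exact h202.neg.exists_refinedInertia (by norm_num [quadRefinedInertia])
  · exact h301.neg.exists_refinedInertia (by norm_num [quadRefinedInertia])
  · exact h400.neg.exists_refinedInertia (by norm_num [quadRefinedInertia])
  · exact h103.exists_refinedInertia (by norm_num [quadRefinedInertia])
  · exact h112.exists_refinedInertia (by norm_num [quadRefinedInertia])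
  · exact h211.neg.exists_refinedInertia (by norm_num [quadRefinedInertia])
  · exact h310.neg.exists_refinedInertia (by norm_num [quadRefinedInertia])
  · exact h202.exists_refinedInertia (by norm_num [quadRefinedInertia])
  · exact h211.exists_refinedInertia (by norm_num [quadRefinedInertia])
  · exact h220.exists_refinedInertia (by norm_num [quadRefinedInertia])
  · exact h301.exists_refinedInertia (by norm_num [quadRefinedInertia])
  · exact h310.exists_refinedInertia (by norm_num [quadRefinedInertia])
  · exact h400.exists_refinedInertia (by norm_num [quadRefinedInertia])

theorem AttainsRealWitnesses.inertiallyArbitrary {𝒜 : ZeroPattern 4}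
    (h : AttainsRealWitnesses 𝒜) : InertiallyArbitrary 𝒜 := by
  intro n₁ n₂ n₃ hn
  obtain ⟨A, hA, hr⟩ := h.exists_refinedInertia hn
  exact ⟨A, hA, by rw [matrixInertia_eq, hr]; rfl⟩

theorem AttainsRealWitnesses.refinedInertiallyArbitrary {𝒜 : ZeroPattern 4}
    (h : AttainsRealWitnesses 𝒜) (h' : AttainsImaginaryWitnesses 𝒜) :
    RefinedInertiallyArbitrary 𝒜 := by
  intro n₁ n₂ n₃ n₄ hn he
  obtain ⟨h2002, h1102, h1012, h0022, h0004⟩ := h'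
  have h4 : n₄ = 0 ∨ n₄ = 2 ∨ n₄ = 4 := by
    obtain ⟨m, rfl⟩ := he; omega
  rcases h4 with rfl | rfl | rfl
  · exact h.exists_refinedInertia hn
  · obtain rfl : n₃ = 2 - n₁ - n₂ := by omega
    have h1 : n₁ ≤ 2 := by omega
    have h2 : n₂ ≤ 2 - n₁ := by omega
    interval_cases n₁ <;> interval_cases n₂
    · exact h0022.exists_refinedInertia (by norm_num [quadRefinedInertia])
    · exact h1012.neg.exists_refinedInertia (by norm_num [quadRefinedInertia])
    · exact h2002.neg.exists_refinedInertia (by norm_num [quadRefinedInertia])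
    · exact h1012.exists_refinedInertia (by norm_num [quadRefinedInertia])
    · exact h1102.exists_refinedInertia (by norm_num [quadRefinedInertia])
    · exact h2002.exists_refinedInertia (by norm_num [quadRefinedInertia])
  · obtain ⟨rfl, rfl, rfl⟩ : n₁ = 0 ∧ n₂ = 0 ∧ n₃ = 0 := by omega
    exact h0004.exists_refinedInertia (by norm_num [quadRefinedInertia])

theorem SpectrallyArbitrary.refinedInertiallyArbitrary {𝒜 : ZeroPattern 4}
    (h : SpectrallyArbitrary 𝒜) : RefinedInertiallyArbitrary 𝒜 := by
  have key : ∀ a b c d, AttainsQuads 𝒜 a b c d := fun a b c d =>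
    h _ (quartic_monic _ _ _ _) (quartic_natDegree _ _ _ _)
  exact AttainsRealWitnesses.refinedInertiallyArbitrary
    ⟨key .., key .., key .., key .., key .., key .., key .., key ..⟩
    ⟨key .., key .., key .., key .., key ..⟩

theorem quadRefinedInertia_fst_le (a b : ℝ) : (quadRefinedInertia a b).1 ≤ 2 := by
  unfold quadRefinedInertia; split_ifs <;> simp

theorem pos_of_two_le_quadRefinedInertia_fst {a b : ℝ} (h : 2 ≤ (quadRefinedInertia a b).1) :
    0 < a ∧ 0 < b := by
  unfold quadRefinedInertia at h
  split_ifs at h <;> simp_all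

/-- An inertially arbitrary pattern admits a spectrum in the open right half-plane. -/
theorem InertiallyArbitrary.exists_pos {𝒜 : ZeroPattern 4} (h : InertiallyArbitrary 𝒜) :
    ∃ a b c d : ℝ, 0 < a ∧ 0 < b ∧ 0 < c ∧ 0 < d ∧ AttainsQuads 𝒜 a b c d := by
  obtain ⟨A, hA, hi⟩ := h 4 0 0 rfl
  obtain ⟨a, b, c, d, hp⟩ := exists_eq_quad_mul_quad A.charpoly_monic (by simp)
  rw [matrixInertia_eq, matrixRefinedInertia_eq, hp, polyRefinedInertia_quad_mul_quad] at hi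
  have h1 := congrArg Prod.fst hi
  simp only [Prod.fst_add] at h1
  have h2 := quadRefinedInertia_fst_le a b
  have h3 := quadRefinedInertia_fst_le c d
  obtain ⟨ha, hb⟩ := pos_of_two_le_quadRefinedInertia_fst (a := a) (b := b) (by omega)
  obtain ⟨hc, hd⟩ := pos_of_two_le_quadRefinedInertia_fst (a := c) (b := d) (by omega)
  exact ⟨a, b, c, d, ha, hb, hc, hd, A, hA, hp.trans (quad_mul_quad a b c d)⟩

theorem eq_zero_and_pos_of_quadRefinedInertia {a b : ℝ}
    (h : 2 ≤ (quadRefinedInertia a b).2.2.2) : a = 0 ∧ 0 < b := by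
  unfold quadRefinedInertia at h
  split_ifs at h <;> simp_all
  linarith

theorem quadRefinedInertia_last_le (a b : ℝ) : (quadRefinedInertia a b).2.2.2 ≤ 2 := by
  unfold quadRefinedInertia; split_ifs <;> simp

/-- A refined inertially arbitrary pattern admits a spectrum of two nonzero purely imaginary
pairs. -/
theorem RefinedInertiallyArbitrary.exists_imaginary {𝒜 : ZeroPattern 4}
    (h : RefinedInertiallyArbitrary 𝒜) :
    ∃ e₂ e₄ : ℝ, 0 < e₂ ∧ 0 < e₄ ∧ quartic 0 e₂ 0 e₄ ∈ charpolySet 𝒜 := by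
  obtain ⟨A, hA, hi⟩ := h 0 0 0 4 rfl (by decide)
  obtain ⟨a, b, c, d, hp⟩ := exists_eq_quad_mul_quad A.charpoly_monic (by simp)
  rw [matrixRefinedInertia_eq, hp, polyRefinedInertia_quad_mul_quad] at hi
  have h1 := congrArg (fun r => r.2.2.2) hi
  simp only [Prod.snd_add] at h1
  have h2 := quadRefinedInertia_last_le a b
  have h3 := quadRefinedInertia_last_le c d
  obtain ⟨rfl, hb⟩ := eq_zero_and_pos_of_quadRefinedInertia (a := a) (b := b) (by omega)
  obtain ⟨rfl, hd⟩ := eq_zero_and_pos_of_quadRefinedInertia (a := c) (b := d) (by omega)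
  exact ⟨b + d, b * d, by positivity, by positivity, A, hA,
    hp.trans (by rw [quad_mul_quad]; simp)⟩

/-! ### Quartics attained by the listed patterns -/

theorem mem_qualitativeClass_iff {𝒜 : ZeroPattern 4} {A : Matrix (Fin 4) (Fin 4) ℝ} :
    A ∈ qualitativeClass 𝒜 ↔
      ((𝒜 0 0 = false → A 0 0 = 0) ∧ (𝒜 0 1 = false → A 0 1 = 0) ∧ (𝒜 0 2 = false → A 0 2 = 0) ∧
        (𝒜 0 3 = false → A 0 3 = 0)) ∧
      ((𝒜 1 0 = false → A 1 0 = 0) ∧ (𝒜 1 1 = false → A 1 1 = 0) ∧ (𝒜 1 2 = false → A 1 2 = 0) ∧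
        (𝒜 1 3 = false → A 1 3 = 0)) ∧
      ((𝒜 2 0 = false → A 2 0 = 0) ∧ (𝒜 2 1 = false → A 2 1 = 0) ∧ (𝒜 2 2 = false → A 2 2 = 0) ∧
        (𝒜 2 3 = false → A 2 3 = 0)) ∧
      ((𝒜 3 0 = false → A 3 0 = 0) ∧ (𝒜 3 1 = false → A 3 1 = 0) ∧ (𝒜 3 2 = false → A 3 2 = 0) ∧
        (𝒜 3 3 = false → A 3 3 = 0)) := by
  simp [qualitativeClass, Fin.forall_fin_succ]

theorem exists_add_eq_mul_eq {s p : ℝ} (h : 4 * p ≤ s ^ 2) :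
    ∃ x y : ℝ, x + y = s ∧ x * y = p ∧ y ≤ x := by
  have hs : √(s ^ 2 - 4 * p) ^ 2 = s ^ 2 - 4 * p := Real.sq_sqrt (by linarith)
  refine ⟨(s + √(s ^ 2 - 4 * p)) / 2, (s - √(s ^ 2 - 4 * p)) / 2, by ring,
    by linear_combination -hs / 4, ?_⟩
  have := Real.sqrt_nonneg (s ^ 2 - 4 * p)
  linarith

/-- Intermediate value theorem on `[-M, M]` with `M = 1 + |e₁| + |e₂| + |e₃|`. -/
theorem exists_cubic_root (e₁ e₂ e₃ : ℝ) : ∃ d : ℝ, d ^ 3 - e₁ * d ^ 2 + e₂ * d - e₃ = 0 := by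
  set M : ℝ := 1 + |e₁| + |e₂| + |e₃| with hM
  have h1 := abs_nonneg e₁
  have h2 := abs_nonneg e₂
  have h3 := abs_nonneg e₃
  have hM1 : 1 ≤ M := by linarith
  have a1 := abs_le.1 (le_refl |e₁|)
  have a2 := abs_le.1 (le_refl |e₂|)
  have a3 := abs_le.1 (le_refl |e₃|)
  have hM2 : M ≤ M ^ 2 := by nlinarith
  have k1 : |e₁| * M ^ 2 + |e₂| * M + |e₃| ≤ M ^ 3 := by
    have : M ^ 3 = (1 + |e₁| + |e₂| + |e₃|) * M ^ 2 := by rw [← hM]; ring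
    rw [this]
    have : |e₂| * M ≤ |e₂| * M ^ 2 := by gcongr
    have : |e₃| * 1 ≤ |e₃| * M ^ 2 := by gcongr; linarith
    nlinarith [sq_nonneg M]
  have hM0 : 0 ≤ M := by linarith
  have b1 : e₁ * M ^ 2 ≤ |e₁| * M ^ 2 := mul_le_mul_of_nonneg_right a1.2 (sq_nonneg M)
  have b1' : -|e₁| * M ^ 2 ≤ e₁ * M ^ 2 := mul_le_mul_of_nonneg_right a1.1 (sq_nonneg M)
  have b2 : e₂ * M ≤ |e₂| * M := mul_le_mul_of_nonneg_right a2.2 hM0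
  have b2' : -|e₂| * M ≤ e₂ * M := mul_le_mul_of_nonneg_right a2.1 hM0
  have hc : ContinuousOn (fun d : ℝ => d ^ 3 - e₁ * d ^ 2 + e₂ * d - e₃) (Set.Icc (-M) M) := by
    fun_prop
  obtain ⟨d, -, hd⟩ := intermediate_value_Icc (by linarith : -M ≤ M) hc
    (show (0 : ℝ) ∈ Set.Icc _ _ from ⟨by nlinarith, by nlinarith⟩)
  exact ⟨d, hd⟩

theorem classCFour_mem {ℬ : ZeroPattern 4} (hℬ : ℬ ∈ classCFour) (e₁ e₂ e₃ e₄ : ℝ) :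
    quartic e₁ e₂ e₃ e₄ ∈ charpolySet ℬ := by
  simp only [classCFour, List.mem_cons, List.not_mem_nil, or_false] at hℬ
  rcases hℬ with rfl | rfl | rfl | rfl | rfl | rfl | rfl | rfl
  · refine quartic_mem_iff.2 ⟨!![e₁, 1, 0, 0; -e₂, 0, 1, 0; e₃, 0, 0, 1; -e₄, 0, 0, 0],
      by simp [mem_qualitativeClass_iff, ofArcs], by simp, by simp, by simp [minor₃],
      by simp [det_fin_four]⟩
  · refine quartic_mem_iff.2 ⟨!![e₁, 1, 0, 0; -e₂, 0, 1, 0; 0, 0, 0, 1; e₁ * e₃ - e₄, e₃, 0, 0],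
      by simp [mem_qualitativeClass_iff, ofArcs], by simp, by simp, by simp [minor₃],
      by simp [det_fin_four]⟩
  · refine quartic_mem_iff.2 ⟨!![e₁, 1, e₃, 0; -e₂, 0, -e₄, 0; 0, 0, 0, 1; 1, 0, 0, 0],
      by simp [mem_qualitativeClass_iff, ofArcs], by simp, by simp, by simp [minor₃],
      by simp [det_fin_four]⟩
  · refine quartic_mem_iff.2 ⟨!![e₁, 1, 0, 0; -e₂, 0, -e₄, e₃; 0, 0, 0, 1; 1, 0, 0, 0],
      by simp [mem_qualitativeClass_iff, ofArcs], by simp, by simp, by simp [minor₃],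
      by simp [det_fin_four]⟩
  · refine quartic_mem_iff.2
      ⟨!![e₁, 1, 0, 0; 0, 0, 1, 0; e₃ - e₁ * e₂, -e₂, 0, 1; -e₄, 0, 0, 0],
      by simp [mem_qualitativeClass_iff, ofArcs], by simp, by simp, by simp [minor₃],
      by simp [det_fin_four]⟩
  · refine quartic_mem_iff.2
      ⟨!![e₁, 1, 0, 0; 0, 0, 1, 0; 0, -e₂, 0, 1; e₁ * (e₃ - e₁ * e₂) - e₄, e₃ - e₁ * e₂, 0, 0],
      by simp [mem_qualitativeClass_iff, ofArcs], by simp, by simp, by simp [minor₃],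
      by simp [det_fin_four]⟩
  · refine quartic_mem_iff.2
      ⟨!![e₁, -e₄, e₃ - e₁ * e₂, 0; 0, 0, 1, 0; 0, -e₂, 0, 1; 1, 0, 0, 0],
      by simp [mem_qualitativeClass_iff, ofArcs], by simp, by simp, by simp [minor₃],
      by simp [det_fin_four]⟩
  · refine quartic_mem_iff.2
      ⟨!![e₁, 1, 0, 0; 0, 0, 1, e₃ - e₁ * e₂; 0, -e₂, 0, -e₄; 1, 0, 0, 0],
      by simp [mem_qualitativeClass_iff, ofArcs], by simp, by simp, by simp [minor₃],
      by simp [det_fin_four]⟩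

/-- The second loop is a root `d` of the cubic, which makes `e₃ = d (e₂ - (e₁ - d) d)`. -/
theorem classYFour_mem {ℬ : ZeroPattern 4} (hℬ : ℬ ∈ classYFour) (e₁ e₂ e₃ e₄ : ℝ) :
    quartic e₁ e₂ e₃ e₄ ∈ charpolySet ℬ := by
  obtain ⟨d, hd⟩ := exists_cubic_root e₁ e₂ e₃
  simp only [classYFour, List.mem_cons, List.not_mem_nil, or_false] at hℬ
  rcases hℬ with rfl | rfl
  · refine quartic_mem_iff.2
      ⟨!![e₁ - d, 1, 0, 0; (e₁ - d) * d - e₂, 0, 1, 0; 0, 0, d, 1; -e₄, 0, 0, 0],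
      by simp [mem_qualitativeClass_iff, ofArcs], by simp, by simp, ?_, by simp [det_fin_four]⟩
    simp [minor₃]
    linear_combination hd
  · refine quartic_mem_iff.2
      ⟨!![e₁ - d, 1, 0, 0; (e₁ - d) * d - e₂, 0, 1, 0; 0, 0, 0, 1; -e₄, 0, 0, d],
      by simp [mem_qualitativeClass_iff, ofArcs], by simp, by simp, ?_, by simp [det_fin_four]⟩
    simp [minor₃]
    linear_combination hd

/-- A sufficient condition for a quartic to be attained by each of `𝒫_{4,1}`, `𝒫_{4,2}` and
`ℛ₁, …, ℛ₇`. In `exists_div`, the number `v` is the coefficient of `e₁` in `e₃` for `ℛ₁`, `ℛ₃`,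
`ℛ₇` and the patterns `𝒫`, the inequality makes the two loops of `ℛ₇` real, and the last part makes
`e₄` solvable for the patterns `𝒫`. The field `four_mul_le` serves `ℛ₂` and `ℛ₅`, the field
`four_mul_sub_le` serves `ℛ₄`, and `exists_factor` is the system of `ℛ₆` with loops `t` and
`e₁ - t`. -/
structure RefinedAdmissible (e₁ e₂ e₃ e₄ : ℝ) : Prop where
  exists_div : ∃ v, e₃ = e₁ * v ∧ 4 * (e₂ - v) ≤ e₁ ^ 2 ∧ (v ≠ 0 ∧ v ≠ e₂ ∨ e₄ = 0)
  four_mul_le : 4 * e₄ ≤ e₂ ^ 2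
  four_mul_sub_le : 4 * (e₄ - e₁ * e₃) ≤ (e₁ ^ 2 - e₂) ^ 2
  exists_factor : ∃ t w, e₄ = t * w ∧ e₃ = (e₂ - t * (e₁ - t)) * (e₁ - t) + w

theorem tableR_mem {ℬ : ZeroPattern 4} (hℬ : ℬ ∈ tableR) {e₁ e₂ e₃ e₄ : ℝ}
    (h : RefinedAdmissible e₁ e₂ e₃ e₄) : quartic e₁ e₂ e₃ e₄ ∈ charpolySet ℬ := by
  obtain ⟨⟨v, hv, hv', -⟩, h1, h2, ⟨t, w, h3, h4⟩⟩ := h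
  simp only [tableR, List.mem_cons, List.not_mem_nil, or_false] at hℬ
  rcases hℬ with rfl | rfl | rfl | rfl | rfl | rfl | rfl
  · refine quartic_mem_iff.2 ⟨!![e₁, v - e₂, -e₄, 0; 1, 0, 0, -v; 0, 0, 0, 1; 0, 1, 0, 0],
      by simp [mem_qualitativeClass_iff, ofArcs], by simp, by simp, by simp [minor₃, hv],
      by simp [det_fin_four]⟩
  · obtain ⟨x, y, rfl, rfl, -⟩ := exists_add_eq_mul_eq h1
    refine quartic_mem_iff.2 ⟨!![e₁, -x, e₃ - e₁ * y, 0; 1, 0, 0, 0; 0, 1, 0, 1; 0, 0, -y, 0],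
      by simp [mem_qualitativeClass_iff, ofArcs], by simp, by simp, by simp [minor₃],
      by simp [det_fin_four]⟩
  · refine quartic_mem_iff.2
      ⟨!![e₁, v - e₂, (e₂ - v) * v - e₄, 0; 1, 0, 0, 0; 0, 0, 0, 1; 0, 1, -v, 0],
      by simp [mem_qualitativeClass_iff, ofArcs], by simp, by simp, by simp [minor₃, hv],
      by simp [det_fin_four]; ring⟩
  -- The product `y` of the arcs of the `2`-cycle on `3, 4` satisfies a quadratic with root sum
  -- `e₂ - e₁ ^ 2` and root product `e₄ - e₁ e₃`.
  · obtain ⟨x, y, hs, hp, -⟩ := exists_add_eq_mul_eq (s := e₂ - e₁ ^ 2) (p := e₄ - e₁ * e₃)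
      (by linarith [sq_abs (e₁ ^ 2 - e₂)])
    refine quartic_mem_iff.2
      ⟨!![e₁, 1, 0, 0; y - e₂, 0, e₃ - e₁ * y, 0; 0, 0, 0, 1; 0, 1, -y, 0],
      by simp [mem_qualitativeClass_iff, ofArcs], by simp, by simp, by simp [minor₃], ?_⟩
    simp [det_fin_four]
    linear_combination hp - y * hs
  · obtain ⟨x, y, rfl, rfl, -⟩ := exists_add_eq_mul_eq h1
    refine quartic_mem_iff.2 ⟨!![e₁, 1, e₃ - e₁ * y, 0; -x, 0, 0, 0; 0, 0, 0, 1; 1, 0, -y, 0],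
      by simp [mem_qualitativeClass_iff, ofArcs], by simp, by simp, by simp [minor₃],
      by simp [det_fin_four]⟩
  · refine quartic_mem_iff.2
      ⟨!![t, 1, 0, 0; t * (e₁ - t) - e₂, 0, 1, 0; 0, 0, e₁ - t, 1; 0, w, 0, 0],
      by simp [mem_qualitativeClass_iff, ofArcs], by simp, by simp, ?_, by simp [det_fin_four, h3]⟩
    simp [minor₃]
    linear_combination -h4
  · obtain ⟨x, y, rfl, hp, -⟩ := exists_add_eq_mul_eq hv'
    refine quartic_mem_iff.2
      ⟨!![x, 1, 0, 0; 0, y, 1, 0; 0, 0, 0, 1; x * y * v - e₄, 0, -v, 0],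
      by simp [mem_qualitativeClass_iff, ofArcs], by simp, ?_, ?_, ?_⟩
    · simp [hp]
    · simp [minor₃]; linear_combination -hv
    · simp [det_fin_four]; ring

theorem pathPattern_one_mem {e₁ e₂ e₃ e₄ : ℝ} (h : RefinedAdmissible e₁ e₂ e₃ e₄) :
    quartic e₁ e₂ e₃ e₄ ∈ charpolySet (pathPattern 4 1) := by
  obtain ⟨v, hv, -, h⟩ := h.exists_div
  obtain ⟨w, hw⟩ : ∃ w, (e₂ - v) * w = e₄ := by
    rcases h with ⟨-, h⟩ | rfl
    · exact ⟨e₄ / (e₂ - v), mul_div_cancel₀ _ (sub_ne_zero.2 h.symm)⟩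
    · exact ⟨0, mul_zero _⟩
  refine quartic_mem_iff.2 ⟨!![e₁, v - e₂, 0, 0; 1, 0, w - v, 0; 0, 1, 0, -w; 0, 0, 1, 0],
      by simp [mem_qualitativeClass_iff, pathPattern], by simp, ?_, ?_, ?_⟩
  · simp
  · simp [minor₃]; linear_combination -hv
  · simp [det_fin_four]; linear_combination hw

theorem pathPattern_two_mem {e₁ e₂ e₃ e₄ : ℝ} (h : RefinedAdmissible e₁ e₂ e₃ e₄) :
    quartic e₁ e₂ e₃ e₄ ∈ charpolySet (pathPattern 4 2) := by
  obtain ⟨v, hv, -, h⟩ := h.exists_div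
  obtain ⟨u, hu⟩ : ∃ u, u * v = e₄ := by
    rcases h with ⟨h, -⟩ | rfl
    · exact ⟨e₄ / v, div_mul_cancel₀ _ h⟩
    · exact ⟨0, zero_mul _⟩
  refine quartic_mem_iff.2 ⟨!![0, -u, 0, 0; 1, e₁, u + v - e₂, 0; 0, 1, 0, -v; 0, 0, 1, 0],
      by simp [mem_qualitativeClass_iff, pathPattern], by simp, ?_, ?_, ?_⟩
  · simp; ring
  · simp [minor₃]; linear_combination -hv
  · simp [det_fin_four]; linear_combination hu

/-- The quartic missed is `X ^ 4 - X` when `e₁` divides `e₃`; it is `X ^ 4 + 1` when two products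
of entries would have sum `0` and product `1`; and for `ℛ₆` it is `X ^ 4 - 1`, since the loop `t`
would satisfy `t ^ 4 = -1`. -/
theorem exists_quartic_not_mem_tableR {ℬ : ZeroPattern 4} (hℬ : ℬ ∈ tableR) :
    ∃ e₁ e₂ e₃ e₄, quartic e₁ e₂ e₃ e₄ ∉ charpolySet ℬ := by
  simp only [tableR, List.mem_cons, List.not_mem_nil, or_false] at hℬ
  rcases hℬ with rfl | rfl | rfl | rfl | rfl | rfl | rfl
  · refine ⟨0, 0, 1, 0, fun h => ?_⟩
    obtain ⟨A, hA, h1, h2, h3, h4⟩ := quartic_mem_iff.1 h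
    simp [mem_qualitativeClass_iff, ofArcs] at hA
    simp [minor₃, det_fin_four, hA] at h1 h2 h3 h4
    simp [h1] at h3
  · refine ⟨0, 0, 0, 1, fun h => ?_⟩
    obtain ⟨A, hA, h1, h2, h3, h4⟩ := quartic_mem_iff.1 h
    simp [mem_qualitativeClass_iff, ofArcs] at hA
    simp [minor₃, det_fin_four, hA] at h1 h2 h3 h4
    have : (A 0 1 * A 1 0) ^ 2 = -1 := by linear_combination -h4 - (A 0 1 * A 1 0) * h2
    linarith [sq_nonneg (A 0 1 * A 1 0)]
  · refine ⟨0, 0, 1, 0, fun h => ?_⟩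
    obtain ⟨A, hA, h1, h2, h3, h4⟩ := quartic_mem_iff.1 h
    simp [mem_qualitativeClass_iff, ofArcs] at hA
    simp [minor₃, det_fin_four, hA] at h1 h2 h3 h4
    simp [h1] at h3
  · refine ⟨0, 0, 0, 1, fun h => ?_⟩
    obtain ⟨A, hA, h1, h2, h3, h4⟩ := quartic_mem_iff.1 h
    simp [mem_qualitativeClass_iff, ofArcs] at hA
    simp [minor₃, det_fin_four, hA] at h1 h2 h3 h4
    have : (A 0 1 * A 1 0) ^ 2 = -1 := by
      linear_combination -h4 - (A 0 1 * A 1 0) * h2 + (A 1 2 * A 2 3 * A 3 1) * h1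
    linarith [sq_nonneg (A 0 1 * A 1 0)]
  · refine ⟨0, 0, 0, 1, fun h => ?_⟩
    obtain ⟨A, hA, h1, h2, h3, h4⟩ := quartic_mem_iff.1 h
    simp [mem_qualitativeClass_iff, ofArcs] at hA
    simp [minor₃, det_fin_four, hA] at h1 h2 h3 h4
    have : (A 0 1 * A 1 0) ^ 2 = -1 := by linear_combination -h4 - (A 0 1 * A 1 0) * h2
    linarith [sq_nonneg (A 0 1 * A 1 0)]
  · refine ⟨0, 0, 0, -1, fun h => ?_⟩
    obtain ⟨A, hA, h1, h2, h3, h4⟩ := quartic_mem_iff.1 h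
    simp [mem_qualitativeClass_iff, ofArcs] at hA
    simp [minor₃, det_fin_four, hA] at h1 h2 h3 h4
    rw [eq_neg_of_add_eq_zero_right h1] at h2 h3
    have : (A 0 0 ^ 2) ^ 2 = -1 := by linear_combination h4 - A 0 0 * h3 - A 0 0 ^ 2 * h2
    linarith [sq_nonneg (A 0 0 ^ 2)]
  · refine ⟨0, 0, 1, 0, fun h => ?_⟩
    obtain ⟨A, hA, h1, h2, h3, h4⟩ := quartic_mem_iff.1 h
    simp [mem_qualitativeClass_iff, ofArcs] at hA
    simp [minor₃, det_fin_four, hA] at h1 h2 h3 h4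
    have : (0 : ℝ) = 1 := by linear_combination h3 + (A 2 3 * A 3 2) * h1
    exact zero_ne_one this

theorem quartic_not_mem_pathPattern_one : quartic 0 0 1 0 ∉ charpolySet (pathPattern 4 1) := by
  intro h
  obtain ⟨A, hA, h1, h2, h3, h4⟩ := quartic_mem_iff.1 h
  simp [mem_qualitativeClass_iff, pathPattern] at hA
  simp [minor₃, det_fin_four, hA] at h1 h2 h3 h4
  simp [h1] at h3

theorem quartic_not_mem_pathPattern_two : quartic 0 0 1 0 ∉ charpolySet (pathPattern 4 2) := by
  intro h
  obtain ⟨A, hA, h1, h2, h3, h4⟩ := quartic_mem_iff.1 h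
  simp [mem_qualitativeClass_iff, pathPattern] at hA
  simp [minor₃, det_fin_four, hA] at h1 h2 h3 h4
  simp [h1] at h3

/-- A sufficient condition for a quartic to be attained by `𝒜₄` and each of the patterns `ℬ` and
`𝒥`. The field `exists_cubic` is the system of `𝒜₄` (whose diagonal entries are the roots of the
cubic), `four_mul_lt` gives distinct real diagonal entries for the patterns `𝒥`, and the other
fields serve the patterns `ℬ`. -/
structure InertialAdmissible (e₁ e₂ e₃ e₄ : ℝ) : Prop where
  four_mul_lt : 4 * e₂ < e₁ ^ 2
  four_mul_le : 4 * e₄ ≤ e₂ ^ 2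
  four_mul_mul_le : 4 * (e₂ * e₄) ≤ e₃ ^ 2 ∧ (e₂ ≠ 0 ∨ e₄ = 0)
  exists_div : ∃ v z, e₃ = e₁ * v + z ∧ e₄ = e₁ * z
  exists_div' : ∃ b, e₄ = b * e₃
  exists_cubic : ∃ x y z, e₁ = x + y + z ∧ e₂ = x * y + x * z + y * z ∧ e₃ = x * y * z

theorem exists_quadratic_root {e₂ e₃ e₄ : ℝ} (h : 4 * (e₂ * e₄) ≤ e₃ ^ 2)
    (h' : e₂ ≠ 0 ∨ e₄ = 0) : ∃ r, e₂ * r ^ 2 - e₃ * r + e₄ = 0 := by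
  rcases h' with h0 | rfl
  · obtain ⟨x, y, hs, hp, -⟩ := exists_add_eq_mul_eq h
    refine ⟨x / e₂, ?_⟩
    field_simp
    linear_combination x * hs - hp
  · exact ⟨0, by ring⟩

theorem cyclePattern_mem {e₁ e₂ e₃ e₄ : ℝ} (h : InertialAdmissible e₁ e₂ e₃ e₄) :
    quartic e₁ e₂ e₃ e₄ ∈ charpolySet (cyclePattern 4) := by
  obtain ⟨x, y, z, h1, h2, h3⟩ := h.exists_cubic
  refine quartic_mem_iff.2 ⟨!![x, 1, 0, 0; 0, y, 1, 0; 0, 0, z, 1; -e₄, 0, 0, 0],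
      by simp [mem_qualitativeClass_iff, cyclePattern], by simp [h1], ?_, ?_, ?_⟩
  · simp [h2]
  · simp [minor₃, h3, mul_assoc]
  · simp [det_fin_four]

/-- In `ℬ₁` and `ℬ₃` the entries depend on a root `r` of `e₂ r² - e₃ r + e₄`. -/
theorem tableB_mem {ℬ : ZeroPattern 4} (hℬ : ℬ ∈ tableB) {e₁ e₂ e₃ e₄ : ℝ}
    (h : InertialAdmissible e₁ e₂ e₃ e₄) : quartic e₁ e₂ e₃ e₄ ∈ charpolySet ℬ := by
  obtain ⟨h1, h2, ⟨h3, h3'⟩, ⟨v, z, hv, hz⟩, ⟨b, hb⟩, -⟩ := h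
  obtain ⟨r, hr⟩ := exists_quadratic_root h3 h3'
  simp only [tableB, List.mem_cons, List.not_mem_nil, or_false] at hℬ
  rcases hℬ with rfl | rfl | rfl | rfl | rfl | rfl | rfl | rfl
  · refine quartic_mem_iff.2
      ⟨!![e₁, -e₂, e₃ - e₂ * r, 0; 1, 0, 0, -r; 0, 1, 0, 0; 1, 0, 0, 0],
      by simp [mem_qualitativeClass_iff, ofArcs], by simp, by simp, ?_, ?_⟩
    · simp [minor₃]
    · simp [det_fin_four]; linear_combination -hr
  · refine quartic_mem_iff.2 ⟨!![e₁, -e₂, e₃ - z, 0; 1, 0, 0, z; 0, 1, 0, 0; 0, 0, 1, 0],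
      by simp [mem_qualitativeClass_iff, ofArcs], by simp, by simp, by simp [minor₃],
      by simp [det_fin_four, hz]⟩
  · refine quartic_mem_iff.2
      ⟨!![e₁, e₁ - r, 0, 0; 0, 0, -e₂, e₃ - e₂ * r; 1, 1, 0, 0; 0, 0, 1, 0],
      by simp [mem_qualitativeClass_iff, ofArcs], by simp, by simp, ?_, ?_⟩
    · simp [minor₃]; ring
    · simp [det_fin_four]; linear_combination -hr
  · refine quartic_mem_iff.2
      ⟨!![e₁, e₃ - e₁ * e₂ - z, 0, 0; 0, 0, 1, -e₂; 1, 0, 0, z; 0, 1, 0, 0],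
      by simp [mem_qualitativeClass_iff, ofArcs], by simp, by simp, ?_, by simp [det_fin_four, hz]⟩
    simp [minor₃]; ring
  · refine quartic_mem_iff.2
      ⟨!![e₁, e₃ - e₁ * e₂ - z, 0, 0; 0, 0, 1, 0; 1, -e₂, 0, z; 0, 1, 0, 0],
      by simp [mem_qualitativeClass_iff, ofArcs], by simp, by simp, ?_, by simp [det_fin_four, hz]⟩
    simp [minor₃]; ring
  · refine quartic_mem_iff.2 ⟨!![e₁, v - e₂, 0, 0; 1, 0, -v, z; 0, 1, 0, 0; 0, 0, 1, 0],
      by simp [mem_qualitativeClass_iff, ofArcs], by simp, by simp, ?_, by simp [det_fin_four, hz]⟩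
    simp [minor₃]; linear_combination -hv
  · refine quartic_mem_iff.2
      ⟨!![e₁ - b, (e₁ - b) * b - e₂, e₃, 0; 1, b, 0, 0; 0, 0, 0, 1; 1, 0, 0, 0],
      by simp [mem_qualitativeClass_iff, ofArcs], by simp, by simp, by simp [minor₃], ?_⟩
    simp [det_fin_four]; linear_combination -hb
  -- The smaller of the two numbers with sum `e₂` and product `e₄` has to be the product of the two
  -- loops, whose sum is `e₁`.
  · obtain ⟨v, m, rfl, hp, hle⟩ := exists_add_eq_mul_eq h2
    obtain ⟨x, y, rfl, rfl, -⟩ := exists_add_eq_mul_eq (s := e₁) (p := m)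
      (by nlinarith [sq_nonneg e₁])
    refine quartic_mem_iff.2
      ⟨!![x, 1, 0, 0; 0, y, 1, 0; e₃ - (x + y) * v, 0, 0, 1; 0, 0, -v, 0],
      by simp [mem_qualitativeClass_iff, ofArcs], by simp, ?_, ?_, ?_⟩
    · simp; ring
    · simp [minor₃]; ring
    · simp [det_fin_four]; linear_combination hp

theorem tableJ_mem {ℬ : ZeroPattern 4} (hℬ : ℬ ∈ tableJ) {e₁ e₂ e₃ e₄ : ℝ}
    (h : InertialAdmissible e₁ e₂ e₃ e₄) : quartic e₁ e₂ e₃ e₄ ∈ charpolySet ℬ := by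
  obtain ⟨x, y, hx, hs, hp⟩ : ∃ x y, x ≠ 0 ∧ x + y = e₁ ∧ x * y = e₂ := by
    obtain ⟨x, y, hs, hp, -⟩ := exists_add_eq_mul_eq h.four_mul_lt.le
    by_cases hx : x = 0
    · refine ⟨y, x, ?_, by rw [← hs, add_comm], by rw [← hp, mul_comm]⟩
      rintro rfl
      have := h.four_mul_lt
      simp [← hs, ← hp, hx] at this
    · exact ⟨x, y, hx, hs, hp⟩
  have hxy : y - x ≠ 0 := by
    intro h0
    obtain rfl : y = x := sub_eq_zero.1 h0
    have := h.four_mul_lt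
    rw [← hs, ← hp] at this
    linarith
  clear h
  subst hs hp
  simp only [tableJ, List.mem_cons, List.not_mem_nil, or_false] at hℬ
  rcases hℬ with rfl | rfl | rfl | rfl | rfl | rfl
  · refine quartic_mem_iff.2 ⟨!![x, y * e₃ - e₄, e₃, 0; 0, y, 1, 0; 0, 0, 0, 1; 1, 0, 0, 0],
      by simp [mem_qualitativeClass_iff, ofArcs], by simp, by simp, by simp [minor₃],
      by simp [det_fin_four]; ring⟩
  · refine quartic_mem_iff.2 ⟨!![x, 1, 0, 0; 0, y, 1, 0; e₃, 0, 0, 1; -e₄, 0, 0, 0],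
      by simp [mem_qualitativeClass_iff, ofArcs], by simp, by simp, by simp [minor₃],
      by simp [det_fin_four]⟩
  · refine quartic_mem_iff.2 ⟨!![x, -e₄, e₃, 0; 0, 0, 1, 0; 0, 0, y, 1; 1, 0, 0, 0],
      by simp [mem_qualitativeClass_iff, ofArcs], by simp, by simp, by simp [minor₃],
      by simp [det_fin_four]⟩
  · refine quartic_mem_iff.2 ⟨!![x, 1, 0, 0; 0, 0, y * e₃ - e₄, e₃; 0, 0, y, 1; 1, 0, 0, 0],
      by simp [mem_qualitativeClass_iff, ofArcs], by simp, by simp, by simp [minor₃],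
      by simp [det_fin_four]; ring⟩
  · refine quartic_mem_iff.2
      ⟨!![x, 1, 0, 0; 0, y, 0, 1; 0, e₄ / x, 0, 0; e₃ - e₄ / x, 0, 1, 0],
      by simp [mem_qualitativeClass_iff, ofArcs], by simp, by simp, by simp [minor₃], ?_⟩
    simp [det_fin_four]; field_simp
  · have hq : (e₄ - x * e₃) / (y - x) * (y - x) = e₄ - x * e₃ := div_mul_cancel₀ _ hxy
    set q := (e₄ - x * e₃) / (y - x)
    refine quartic_mem_iff.2 ⟨!![x, 1, 0, 0; 0, 0, 0, 1; 0, e₃ - q, y, 0; q, 0, 1, 0],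
      by simp [mem_qualitativeClass_iff, ofArcs], by simp, by simp, by simp [minor₃], ?_⟩
    simp [det_fin_four]; linear_combination hq

/-- The sum of squares of three reals with sum `0` is `-2 e₂`. -/
theorem not_mem_cyclePattern {e₂ e₄ : ℝ} (h₂ : 0 < e₂) :
    quartic 0 e₂ 0 e₄ ∉ charpolySet (cyclePattern 4) := by
  intro h
  obtain ⟨A, hA, h1, h2, h3, h4⟩ := quartic_mem_iff.1 h
  simp [mem_qualitativeClass_iff, cyclePattern] at hA
  simp [minor₃, det_fin_four, hA] at h1 h2 h3 h4
  nlinarith [sq_nonneg (A 0 0 + A 1 1 + A 2 2), sq_nonneg (A 0 0), sq_nonneg (A 1 1),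
    sq_nonneg (A 2 2)]

/-- Here `e₁` and `e₂` are the sum and the product of two real loops. -/
theorem not_mem_tableJ {ℬ : ZeroPattern 4} (hℬ : ℬ ∈ tableJ) {e₂ e₄ : ℝ} (h₂ : 0 < e₂) :
    quartic 0 e₂ 0 e₄ ∉ charpolySet ℬ := by
  intro h
  obtain ⟨A, hA, h1, h2, -, -⟩ := quartic_mem_iff.1 h
  simp only [tableJ, List.mem_cons, List.not_mem_nil, or_false] at hℬ
  rcases hℬ with rfl | rfl | rfl | rfl | rfl | rfl <;>
  · simp [mem_qualitativeClass_iff, ofArcs] at hA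
    simp [hA] at h1 h2
    rw [eq_neg_of_add_eq_zero_right h1] at h2
    nlinarith [sq_nonneg (A 0 0)]

/-- In `ℬ₁` and `ℬ₃`, when `e₁ = 0`, the two terms of `e₃` have product `e₂ e₄`, so that `e₃ = 0`
gives `e₂ e₄ ≤ 0`. In the other patterns `e₁ = e₃ = 0` forces `e₄ ≤ 0` or `e₂ ≤ 0` directly. -/
theorem not_mem_tableB {ℬ : ZeroPattern 4} (hℬ : ℬ ∈ tableB) {e₂ e₄ : ℝ} (h₂ : 0 < e₂)
    (h₄ : 0 < e₄) : quartic 0 e₂ 0 e₄ ∉ charpolySet ℬ := by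
  intro h
  obtain ⟨A, hA, h1, h2, h3, h4⟩ := quartic_mem_iff.1 h
  simp only [tableB, List.mem_cons, List.not_mem_nil, or_false] at hℬ
  rcases hℬ with rfl | rfl | rfl | rfl | rfl | rfl | rfl | rfl <;>
    simp [mem_qualitativeClass_iff, ofArcs] at hA <;>
    simp [minor₃, det_fin_four, hA] at h1 h2 h3 h4
  · have : (A 0 2 * A 1 0 * A 2 1) ^ 2 = -(e₂ * e₄) := by
      rw [← h2, ← h4]
      linear_combination (A 0 2 * A 1 0 * A 2 1) * h3
    nlinarith [sq_nonneg (A 0 2 * A 1 0 * A 2 1), mul_pos h₂ h₄]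
  · simp [h1] at h4
    linarith
  · simp only [h1, zero_mul, neg_zero, zero_add, zero_sub] at h3 h4
    have : (A 0 1 * A 1 2 * A 2 0) ^ 2 = -(e₂ * e₄) := by
      rw [← h2, ← h4]
      linear_combination (A 0 1 * A 1 2 * A 2 0) * h3
    nlinarith [sq_nonneg (A 0 1 * A 1 2 * A 2 0), mul_pos h₂ h₄]
  · simp [h1] at h4
    linarith
  · simp [h1] at h4
    linarith
  · simp [h1] at h4
    linarith
  · rcases h3 with h | h | h <;>
    · simp [h] at h4
      linarith
  · rw [eq_neg_of_add_eq_zero_right h1] at h2 h4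
    have : e₄ = -(A 0 0 ^ 2 * (e₂ + A 0 0 ^ 2)) := by
      linear_combination -h4 - A 0 0 ^ 2 * h2
    have : 0 ≤ A 0 0 ^ 2 * (e₂ + A 0 0 ^ 2) := by positivity
    linarith

/-- The spectra of `AttainsRealWitnesses` are real, with roots chosen such that every discriminant
condition holds and the remaining equations have rational solutions. -/
theorem attainsRealWitnesses_of_RefinedAdmissible {𝒜 : ZeroPattern 4}
    (h : ∀ e₁ e₂ e₃ e₄, RefinedAdmissible e₁ e₂ e₃ e₄ → quartic e₁ e₂ e₃ e₄ ∈ charpolySet 𝒜) :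
    AttainsRealWitnesses 𝒜 where
  w400 := h _ _ _ _ ⟨⟨597 / 13, by norm_num⟩, by norm_num, by norm_num, ⟨55, 40, by norm_num⟩⟩
  w310 := h _ _ _ _ ⟨⟨-296 / 15, by norm_num⟩, by norm_num, by norm_num, ⟨4, -21, by norm_num⟩⟩
  w220 := h _ _ _ _ ⟨⟨-3, by norm_num⟩, by norm_num, by norm_num, ⟨5, 8, by norm_num⟩⟩
  w301 := h _ _ _ _ ⟨⟨1 / 5, by norm_num⟩, by norm_num, by norm_num, ⟨0, -24, by norm_num⟩⟩
  w211 := h _ _ _ _ ⟨⟨-1, by norm_num⟩, by norm_num, by norm_num, ⟨0, 0, by norm_num⟩⟩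
  w202 := h _ _ _ _ ⟨⟨0, by norm_num⟩, by norm_num, by norm_num, ⟨0, -6, by norm_num⟩⟩
  w112 := h _ _ _ _ ⟨⟨0, by norm_num⟩, by norm_num, by norm_num, ⟨0, 0, by norm_num⟩⟩
  w103 := h _ _ _ _ ⟨⟨0, by norm_num⟩, by norm_num, by norm_num, ⟨0, 0, by norm_num⟩⟩

theorem attainsImaginaryWitnesses_of_RefinedAdmissible {𝒜 : ZeroPattern 4}
    (h : ∀ e₁ e₂ e₃ e₄, RefinedAdmissible e₁ e₂ e₃ e₄ → quartic e₁ e₂ e₃ e₄ ∈ charpolySet 𝒜) :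
    AttainsImaginaryWitnesses 𝒜 where
  w2002 := h _ _ _ _ ⟨⟨1, by norm_num⟩, by norm_num, by norm_num, ⟨1, 1, by norm_num⟩⟩
  w1102 := h _ _ _ _ ⟨⟨1, by norm_num⟩, by norm_num, by norm_num, ⟨-3, 3, by norm_num⟩⟩
  w1012 := h _ _ _ _ ⟨⟨1, by norm_num⟩, by norm_num, by norm_num, ⟨0, 0, by norm_num⟩⟩
  w0022 := h _ _ _ _ ⟨⟨1, by norm_num⟩, by norm_num, by norm_num, ⟨0, 0, by norm_num⟩⟩
  w0004 := h _ _ _ _ ⟨⟨6, by norm_num⟩, by norm_num, by norm_num, ⟨1, 6, by norm_num⟩⟩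

/-- A cubic with a root `z` is real-rooted if the remaining quadratic has nonnegative
discriminant. -/
theorem exists_cubic_of_root {e₁ e₂ e₃ : ℝ} (z : ℝ) (hz : e₃ = (e₂ - z * (e₁ - z)) * z)
    (h : 4 * (e₂ - z * (e₁ - z)) ≤ (e₁ - z) ^ 2) :
    ∃ x y z, e₁ = x + y + z ∧ e₂ = x * y + x * z + y * z ∧ e₃ = x * y * z := by
  obtain ⟨x, y, hs, hp, -⟩ := exists_add_eq_mul_eq h
  exact ⟨x, y, z, by linarith, by linear_combination -hp - z * hs, by rw [hp, hz]⟩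

theorem attainsRealWitnesses_of_InertialAdmissible {𝒜 : ZeroPattern 4}
    (h : ∀ e₁ e₂ e₃ e₄, InertialAdmissible e₁ e₂ e₃ e₄ → quartic e₁ e₂ e₃ e₄ ∈ charpolySet 𝒜) :
    AttainsRealWitnesses 𝒜 where
  w400 := h _ _ _ _ ⟨by norm_num, by norm_num, by norm_num,
    ⟨(3582 - 1100 / 39) / 78, 1100 / 39, by norm_num⟩, ⟨1100 / 1791, by norm_num⟩,
    exists_cubic_of_root 3 (by norm_num) (by norm_num)⟩
  w310 := h _ _ _ _ ⟨by norm_num, by norm_num, by norm_num,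
    ⟨(-296 + 28 / 5) / 15, -28 / 5, by norm_num⟩, ⟨21 / 74, by norm_num⟩,
    exists_cubic_of_root 8 (by norm_num) (by norm_num)⟩
  w220 := h _ _ _ _ ⟨by norm_num, by norm_num, by norm_num,
    ⟨(-18 - 20 / 3) / 6, 20 / 3, by norm_num⟩, ⟨-20 / 9, by norm_num⟩,
    exists_cubic_of_root (-3) (by norm_num) (by norm_num)⟩
  w301 := h _ _ _ _ ⟨by norm_num, by norm_num, by norm_num,
    ⟨1 / 5, 0, by norm_num⟩, ⟨0, by norm_num⟩,
    exists_cubic_of_root 1 (by norm_num) (by norm_num)⟩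
  w211 := h _ _ _ _ ⟨by norm_num, by norm_num, by norm_num,
    ⟨-1, 0, by norm_num⟩, ⟨0, by norm_num⟩,
    exists_cubic_of_root 1 (by norm_num) (by norm_num)⟩
  w202 := h _ _ _ _ ⟨by norm_num, by norm_num, by norm_num,
    ⟨0, 0, by norm_num⟩, ⟨0, by norm_num⟩,
    exists_cubic_of_root 0 (by norm_num) (by norm_num)⟩
  w112 := h _ _ _ _ ⟨by norm_num, by norm_num, by norm_num,
    ⟨0, 0, by norm_num⟩, ⟨0, by norm_num⟩,
    exists_cubic_of_root 0 (by norm_num) (by norm_num)⟩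
  w103 := h _ _ _ _ ⟨by norm_num, by norm_num, by norm_num,
    ⟨0, 0, by norm_num⟩, ⟨0, by norm_num⟩,
    exists_cubic_of_root 0 (by norm_num) (by norm_num)⟩

/-! ### Enumeration of the irreducible patterns with seven arcs -/

/-- Sets of patterns of order `4` are encoded as natural numbers below `2 ^ 2 ^ 16`: the binary
digit at position `code 𝒜` tells whether `𝒜` belongs to the set. Intersections and unions become
bitwise operations, so that the classification is a single equation between numbers. The code of a pattern
has the entries of the pattern, row by row, as its binary digits. -/
def code (𝒜 : ZeroPattern 4) : ℕ :=
  Nat.ofBits fun k : Fin (4 * 4) => 𝒜 k.divNat k.modNat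

theorem testBit_code (𝒜 : ZeroPattern 4) (i j : Fin 4) :
    (code 𝒜).testBit (4 * i + j) = 𝒜 i j := by
  unfold code
  rw [Nat.testBit_ofBits_lt _ _ (by omega)]
  fin_cases i <;> fin_cases j <;> rfl

theorem code_lt (𝒜 : ZeroPattern 4) : code 𝒜 < 2 ^ 16 := Nat.ofBits_lt_two_pow _

theorem code_injective : Function.Injective code := by
  intro 𝒜 ℬ h
  ext i j
  rw [← testBit_code 𝒜, ← testBit_code ℬ, h]

theorem sum_testBit_code (𝒜 : ZeroPattern 4) :
    ∑ k ∈ Finset.range 16, ((code 𝒜).testBit k).toNat = numNonzero 𝒜 := by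
  rw [← Fin.sum_univ_eq_sum_range (fun k => ((code 𝒜).testBit k).toNat) (4 * 4), numNonzero,
    Finset.card_filter]
  refine (Fintype.sum_equiv finProdFinEquiv _ _ fun p => ?_).symm
  have h : (code 𝒜).testBit (finProdFinEquiv p) = 𝒜 p.1 p.2 := by
    rw [← testBit_code 𝒜]
    congr 1
    simp [finProdFinEquiv]
    ring
  rw [h]
  cases 𝒜 p.1 p.2 <;> rfl

/-- All codes below `2 ^ n`. -/
def fullTable (n : ℕ) : ℕ := 2 ^ 2 ^ n - 1

theorem testBit_fullTable {n m : ℕ} (hm : m < 2 ^ n) : (fullTable n).testBit m = true := by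
  rw [fullTable, Nat.testBit_two_pow_sub_one, decide_eq_true hm]

/-- The codes below `2 ^ n` with digit `k` equal to `1`. -/
def digitTable : ℕ → ℕ → ℕ
  | 0, _ => 0
  | n + 1, k => if k = n then fullTable n <<< 2 ^ n
      else digitTable n k ||| digitTable n k <<< 2 ^ n

theorem testBit_sub_two_pow {n k m : ℕ} (hk : k < n) (hm : 2 ^ n ≤ m) :
    (m - 2 ^ n).testBit k = m.testBit k := by
  obtain ⟨r, rfl⟩ := Nat.exists_eq_add_of_le hm
  rw [Nat.add_sub_cancel_left, Nat.testBit_two_pow_add_gt hk]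

theorem testBit_digitTable {n k m : ℕ} (hm : m < 2 ^ n) (h : m.testBit k = true) :
    (digitTable n k).testBit m = true := by
  induction n generalizing m with
  | zero => simp_all
  | succ n ih =>
    have hp : 2 ^ (n + 1) = 2 ^ n + 2 ^ n := by ring
    unfold digitTable
    split_ifs with hk
    · subst hk
      have h1 : 2 ^ k ≤ m := Nat.ge_two_pow_of_testBit h
      rw [Nat.testBit_shiftLeft, testBit_fullTable (by omega)]
      simp [h1]
    · rw [Nat.testBit_or, Nat.testBit_shiftLeft]
      rcases lt_or_ge m (2 ^ n) with h1 | h1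
      · simp [ih h1 h]
      · have h2 : k < n := by
          by_contra h3
          have := Nat.ge_two_pow_of_testBit h
          have : 2 ^ (n + 1) ≤ 2 ^ k := Nat.pow_le_pow_right (by norm_num) (by omega)
          omega
        simp [h1, ih (m := m - 2 ^ n) (by omega) (by rw [testBit_sub_two_pow h2 h1, h])]

/-- The codes below `2 ^ n` with exactly `w` digits `1`. -/
def weightTable : ℕ → ℕ → ℕ
  | 0, 0 => 1
  | 0, _ + 1 => 0
  | n + 1, 0 => weightTable n 0
  | n + 1, w + 1 => weightTable n (w + 1) ||| weightTable n w <<< 2 ^ n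

theorem testBit_weightTable {n w m : ℕ} (hm : m < 2 ^ n)
    (h : ∑ k ∈ Finset.range n, (m.testBit k).toNat = w) :
    (weightTable n w).testBit m = true := by
  induction n generalizing m w with
  | zero =>
    obtain rfl : m = 0 := by simpa using hm
    obtain rfl : w = 0 := by simpa using h.symm
    rfl
  | succ n ih =>
    have hp : 2 ^ (n + 1) = 2 ^ n + 2 ^ n := by ring
    rw [Finset.sum_range_succ] at h
    rcases lt_or_ge m (2 ^ n) with h1 | h1
    · rw [Nat.testBit_lt_two_pow h1, Bool.toNat_false, add_zero] at h
      cases w with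
      | zero => exact ih h1 h
      | succ w => rw [weightTable, Nat.testBit_or, ih h1 h, Bool.true_or]
    · have h2 : m.testBit n = true := by
        have h3 := Nat.testBit_two_pow_add_eq (m - 2 ^ n) n
        have h4 : (m - 2 ^ n).testBit n = false := Nat.testBit_lt_two_pow (by omega)
        rw [Nat.add_sub_cancel' h1, h4] at h3
        exact h3
      rw [h2, Bool.toNat_true] at h
      obtain ⟨w, rfl⟩ : ∃ v, w = v + 1 := ⟨_, h.symm⟩
      have h4 : (weightTable n w).testBit (m - 2 ^ n) = true := by
        refine ih (by omega) ?_
        rw [← Nat.add_right_cancel h]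
        exact Finset.sum_congr rfl fun k hk => by
          rw [testBit_sub_two_pow (Finset.mem_range.1 hk) h1]
      rw [weightTable, Nat.testBit_or, Nat.testBit_shiftLeft, h4]
      simp [h1]

theorem testBit_foldr_or {α : Type*} (l : List α) (f : α → ℕ) (m : ℕ) :
    (l.foldr (fun a s => f a ||| s) 0).testBit m = l.any fun a => (f a).testBit m := by
  induction l with
  | nil => simp
  | cons a l ih => simp [ih, Nat.testBit_or]

theorem testBit_foldr_and {α : Type*} (l : List α) (f : α → ℕ) (s m : ℕ) :
    (l.foldr (fun a s => f a &&& s) s).testBit m =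
      (l.all (fun a => (f a).testBit m) && s.testBit m) := by
  induction l with
  | nil => simp
  | cons a l ih => simp [ih, Nat.testBit_and, Bool.and_assoc]

/-- The codes of the patterns with the arc from `i` to `j`. -/
def arcTable (i j : Fin 4) : ℕ := digitTable 16 (4 * i + j)

theorem testBit_arcTable {𝒜 : ZeroPattern 4} {i j : Fin 4} (h : 𝒜 i j = true) :
    (arcTable i j).testBit (code 𝒜) = true :=
  testBit_digitTable (code_lt 𝒜) ((testBit_code 𝒜 i j).trans h)

/-- The codes of the patterns with an arc leaving the vertex set whose characteristic digits are
those of `t`. -/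
def cutTable (t : ℕ) : ℕ :=
  ((List.finRange 4).product (List.finRange 4)).foldr
    (fun p s => (if t.testBit p.1 && !t.testBit p.2 then arcTable p.1 p.2 else 0) ||| s) 0

/-- Every nonempty proper set of vertices can be moved to the end of the vertex order. -/
theorem exists_sorting_perm : ∀ t ∈ List.range' 1 14, ∃ σ : Equiv.Perm (Fin 4), ∃ k : Fin 4,
    0 < k ∧ ∀ i j : Fin 4, k ≤ i → j < k → (t.testBit (σ i) && !t.testBit (σ j)) = true := by
  decide +kernel

theorem IsIrreducible.testBit_cutTable {𝒜 : ZeroPattern 4} (h : IsIrreducible 𝒜) {t : ℕ}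
    (ht : t ∈ List.range' 1 14) : (cutTable t).testBit (code 𝒜) = true := by
  obtain ⟨σ, k, hk, hσ⟩ := exists_sorting_perm t ht
  by_contra hc
  refine h ⟨σ, k, hk, k.2, fun i j hi hj => ?_⟩
  by_contra hij
  rw [Bool.not_eq_false] at hij
  refine hc ?_
  rw [cutTable, testBit_foldr_or, List.any_eq_true]
  exact ⟨(σ i, σ j), List.pair_mem_product.2 ⟨List.mem_finRange _, List.mem_finRange _⟩, by
    rw [if_pos (hσ i j hi hj)]; exact testBit_arcTable hij⟩

/-- The codes of the patterns that admit a permutation `σ` with an arc in each of the positions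
`(i, σ i)`, when `M i j` holds the codes of the patterns with an arc in position `(i, j)`. -/
def transversalTable : (n : ℕ) → Matrix (Fin n) (Fin n) ℕ → ℕ
  | 0, _ => fullTable 16
  | n + 1, M => (List.finRange (n + 1)).foldr (fun j s =>
      (M 0 j &&& transversalTable n (M.submatrix Fin.succ j.succAbove)) ||| s) 0

theorem det_eq_zero_of_testBit_transversalTable {m : ℕ} (hm : m < 2 ^ 16) {n : ℕ}
    {M : Matrix (Fin n) (Fin n) ℕ} {A : Matrix (Fin n) (Fin n) ℝ}
    (hA : ∀ i j, (M i j).testBit m = false → A i j = 0)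
    (h : (transversalTable n M).testBit m = false) : A.det = 0 := by
  induction n with
  | zero =>
    rw [transversalTable, testBit_fullTable hm] at h
    exact absurd h (by decide)
  | succ n ih =>
    rw [transversalTable, testBit_foldr_or, List.any_eq_false] at h
    rw [Matrix.det_succ_row_zero]
    refine Finset.sum_eq_zero fun j _ => ?_
    have hj := h j (List.mem_finRange j)
    rw [Nat.testBit_and, Bool.and_eq_true, not_and_or, Bool.not_eq_true, Bool.not_eq_true] at hj
    rcases hj with hj | hj
    · rw [hA 0 j hj]; ring
    · rw [ih (A := A.submatrix Fin.succ j.succAbove) (fun i l => hA i.succ (j.succAbove l)) hj]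
      ring

/-- The codes of the patterns with a nonzero term in one of the principal minors on the given
index sets. -/
def minorTable (k : ℕ) (l : List (Fin k → Fin 4)) : ℕ :=
  l.foldr (fun f s => transversalTable k ((Matrix.of arcTable).submatrix f f) ||| s) 0

theorem det_submatrix_eq_zero {𝒜 : ZeroPattern 4} {A : Matrix (Fin 4) (Fin 4) ℝ}
    (hA : A ∈ qualitativeClass 𝒜) {k : ℕ} {l : List (Fin k → Fin 4)}
    (h : (minorTable k l).testBit (code 𝒜) = false) {f : Fin k → Fin 4} (hf : f ∈ l) :
    (A.submatrix f f).det = 0 := by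
  rw [minorTable, testBit_foldr_or, List.any_eq_false] at h
  refine det_eq_zero_of_testBit_transversalTable (code_lt 𝒜) (fun i j hij => hA _ _ ?_)
    (Bool.eq_false_iff.2 (h f hf))
  by_contra hc
  rw [Bool.not_eq_false] at hc
  exact absurd (testBit_arcTable hc) (by simpa using hij)

/-- The codes of the patterns none of whose generic characteristic coefficients is trivially
zero. -/
def coefficientTable : ℕ :=
  minorTable 1 [![0], ![1], ![2], ![3]] &&&
  (minorTable 2 [![0, 1], ![0, 2], ![0, 3], ![1, 2], ![1, 3], ![2, 3]] &&&
  (minorTable 3 [![0, 1, 2], ![0, 1, 3], ![0, 2, 3], ![1, 2, 3]] &&&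
  minorTable 4 [id]))

/-- A pattern without a spectrum in the open right half-plane is not inertially arbitrary, and such
a spectrum makes all four coefficients nonzero. -/
theorem InertiallyArbitrary.testBit_coefficientTable {𝒜 : ZeroPattern 4}
    (h : InertiallyArbitrary 𝒜) : coefficientTable.testBit (code 𝒜) = true := by
  obtain ⟨a, b, c, d, ha, hb, hc, hd, A, hA, hp⟩ := h.exists_pos
  obtain ⟨h1, h2, h3, h4⟩ := quartic_inj ((charpoly_fin_four A).symm.trans hp)
  simp only [coefficientTable, Nat.testBit_and, Bool.and_eq_true]
  refine ⟨?_, ?_, ?_, ?_⟩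
  · by_contra h
    have key := fun f hf => det_submatrix_eq_zero hA (Bool.eq_false_iff.2 h) (f := f) hf
    simp at key
    have : 0 < a + c := by positivity
    rw [← h1, key.1, key.2.1, key.2.2.1, key.2.2.2] at this
    simp at this
  · by_contra h
    have key := fun f hf => det_submatrix_eq_zero hA (Bool.eq_false_iff.2 h) (f := f) hf
    have : 0 < b + d + a * c := by positivity
    rw [← h2] at this
    rw [key _ (by simp), key _ (by simp), key _ (by simp), key _ (by simp), key _ (by simp),
      key _ (by simp)] at this
    simp at this
  · by_contra h
    have key := fun f hf => det_submatrix_eq_zero hA (Bool.eq_false_iff.2 h) (f := f) hf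
    have : 0 < a * d + b * c := by positivity
    rw [← h3] at this
    rw [key _ (by simp), key _ (by simp), key _ (by simp), key _ (by simp)] at this
    simp at this
  · by_contra h
    have key := fun f hf => det_submatrix_eq_zero hA (Bool.eq_false_iff.2 h) (f := f) hf
    have : 0 < b * d := by positivity
    rw [← h4] at this
    have h0 := key id (by simp)
    rw [Matrix.submatrix_id_id] at h0
    rw [h0] at this
    exact lt_irrefl _ this

/-- All permutations of `Fin 4`, as products of transpositions. Completeness of the list is
not needed. -/
def perms : List (Equiv.Perm (Fin 4)) :=
  [1, Equiv.swap 0 1, Equiv.swap 0 2, Equiv.swap 0 3].flatMap fun σ =>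
    [1, Equiv.swap 1 2, Equiv.swap 1 3].flatMap fun τ =>
      [1, Equiv.swap 2 3].map fun ρ => σ * τ * ρ

/-- Up to equivalence, the only irreducible pattern with seven arcs beyond the listed ones none of
whose coefficients `e_k` is trivially zero. It satisfies `e₃ = e₁ e₂`. -/
def resonantPattern : ZeroPattern 4 :=
  ofArcs 4 [(1, 1), (1, 2), (2, 3), (3, 2), (3, 4), (4, 1), (4, 3)]

/-- The patterns, up to equivalence, that are irreducible, have seven arcs and no trivially zero
coefficient. -/
def representatives : List (ZeroPattern 4) :=
  resonantPattern :: pathPattern 4 1 :: pathPattern 4 2 :: cyclePattern 4 ::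
    (classCFour ++ classYFour ++ tableR ++ tableB ++ tableJ)

/-- The codes of the patterns equivalent to `ℬ`. -/
def orbitTable (ℬ : ZeroPattern 4) : ℕ :=
  perms.foldr (fun σ s => (2 ^ code (Matrix.of fun i j => ℬ (σ i) (σ j)) |||
    2 ^ code (Matrix.of fun i j => ℬ (σ j) (σ i))) ||| s) 0

theorem equivalent_of_testBit_orbitTable {𝒜 ℬ : ZeroPattern 4}
    (h : (orbitTable ℬ).testBit (code 𝒜) = true) : Equivalent 𝒜 ℬ := by
  rw [orbitTable, testBit_foldr_or, List.any_eq_true] at h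
  obtain ⟨σ, -, h⟩ := h
  rw [Nat.testBit_or, Bool.or_eq_true, Nat.testBit_two_pow, Nat.testBit_two_pow, decide_eq_true_eq,
    decide_eq_true_eq] at h
  refine ⟨σ⁻¹, h.imp (fun h i j => ?_) (fun h i j => ?_)⟩ <;>
  · rw [← code_injective h]
    simp

set_option maxRecDepth 100000 in
/-- The codes of the patterns with seven arcs that are irreducible and have no trivially zero
coefficient are codes of patterns equivalent to a representative (`a ||| b = b` means that `a`
encodes a subset of `b`). -/
theorem classification : ((List.range' 1 14).foldr (fun t s => cutTable t &&& s)
      (weightTable 16 7 &&& coefficientTable)) |||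
        representatives.foldr (fun ℬ s => orbitTable ℬ ||| s) 0 =
      representatives.foldr (fun ℬ s => orbitTable ℬ ||| s) 0 := by
  decide +kernel

theorem exists_equivalent {𝒜 : ZeroPattern 4} (hirr : IsIrreducible 𝒜) (h7 : numNonzero 𝒜 = 7)
    (hi : InertiallyArbitrary 𝒜) : ∃ ℬ ∈ representatives, Equivalent 𝒜 ℬ := by
  have h := congrArg (Nat.testBit · (code 𝒜)) classification
  simp only [Nat.testBit_or, testBit_foldr_and, Nat.testBit_and] at h
  rw [testBit_weightTable (code_lt 𝒜) ((sum_testBit_code 𝒜).trans h7),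
    hi.testBit_coefficientTable,
    List.all_eq_true.2 fun t ht => hirr.testBit_cutTable ht] at h
  simp only [Bool.and_self, Bool.true_or] at h
  rw [eq_comm, testBit_foldr_or, List.any_eq_true] at h
  obtain ⟨ℬ, hℬ, h⟩ := h
  exact ⟨ℬ, hℬ, equivalent_of_testBit_orbitTable h⟩

/-! ### The classification -/

theorem spectrallyArbitrary_of_forall_mem {𝒜 : ZeroPattern 4}
    (h : ∀ e₁ e₂ e₃ e₄, quartic e₁ e₂ e₃ e₄ ∈ charpolySet 𝒜) : SpectrallyArbitrary 𝒜 := by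
  intro p hp hd
  obtain ⟨e₁, e₂, e₃, e₄, rfl⟩ := exists_eq_quartic hp hd
  exact h e₁ e₂ e₃ e₄

theorem not_spectrallyArbitrary_of_not_mem {𝒜 : ZeroPattern 4}
    (h : ∃ e₁ e₂ e₃ e₄, quartic e₁ e₂ e₃ e₄ ∉ charpolySet 𝒜) : ¬ SpectrallyArbitrary 𝒜 := by
  obtain ⟨e₁, e₂, e₃, e₄, h⟩ := h
  exact fun h' => h (h' _ (quartic_monic _ _ _ _) (quartic_natDegree _ _ _ _))

/-- For `(X ^ 2 - a X + b) (X ^ 2 - c X + d)` with positive coefficients,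
`e₁ e₂ - e₃ = a b + c d + a c (a + c)` is positive. -/
theorem not_inertiallyArbitrary_of_equivalent_resonantPattern {𝒜 : ZeroPattern 4}
    (h : Equivalent 𝒜 resonantPattern) : ¬ InertiallyArbitrary 𝒜 := by
  intro hi
  obtain ⟨a, b, c, d, ha, hb, hc, hd, hp⟩ := hi.exists_pos
  unfold AttainsQuads at hp
  rw [h.charpolySet_eq, quartic_mem_iff] at hp
  obtain ⟨A, hA, h1, h2, h3, -⟩ := hp
  simp [mem_qualitativeClass_iff, resonantPattern, ofArcs] at hA
  simp [minor₃, hA] at h1 h2 h3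
  have h4 : a * d + b * c = (a + c) * (b + d + a * c) := by
    rw [← h3, ← h2, ← h1]; ring
  have : 0 < a * b + c * d + (a + c) * (a * c) := by positivity
  linarith

end ZeroPattern

theorem theorem7p4 (𝒜 : ZeroPattern 4) (hirr : ZeroPattern.IsIrreducible 𝒜)
    (hseven : ZeroPattern.numNonzero 𝒜 = 7) :
    (ZeroPattern.SpectrallyArbitrary 𝒜 ↔
      ((∃ ℬ ∈ ZeroPattern.classCFour, ZeroPattern.Equivalent 𝒜 ℬ) ∨
        (∃ ℬ ∈ ZeroPattern.classYFour, ZeroPattern.Equivalent 𝒜 ℬ))) ∧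
    ((ZeroPattern.RefinedInertiallyArbitrary 𝒜 ∧ ¬ ZeroPattern.SpectrallyArbitrary 𝒜) ↔
      (ZeroPattern.Equivalent 𝒜 (ZeroPattern.pathPattern 4 1) ∨
        ZeroPattern.Equivalent 𝒜 (ZeroPattern.pathPattern 4 2) ∨
        (∃ ℬ ∈ ZeroPattern.tableR, ZeroPattern.Equivalent 𝒜 ℬ))) ∧
    ((ZeroPattern.InertiallyArbitrary 𝒜 ∧ ¬ ZeroPattern.RefinedInertiallyArbitrary 𝒜) ↔
      (ZeroPattern.Equivalent 𝒜 (ZeroPattern.cyclePattern 4) ∨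
        (∃ ℬ ∈ ZeroPattern.tableB, ZeroPattern.Equivalent 𝒜 ℬ) ∨
        (∃ ℬ ∈ ZeroPattern.tableJ, ZeroPattern.Equivalent 𝒜 ℬ))) := by
  open ZeroPattern in
  have hS : ((∃ ℬ ∈ classCFour, Equivalent 𝒜 ℬ) ∨ (∃ ℬ ∈ classYFour, Equivalent 𝒜 ℬ)) →
      SpectrallyArbitrary 𝒜 := by
    rintro (⟨ℬ, hℬ, h⟩ | ⟨ℬ, hℬ, h⟩) <;> refine spectrallyArbitrary_of_forall_mem ?_ <;>
      rw [h.charpolySet_eq]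
    · exact classCFour_mem hℬ
    · exact classYFour_mem hℬ
  have hR : (Equivalent 𝒜 (pathPattern 4 1) ∨ Equivalent 𝒜 (pathPattern 4 2) ∨
      (∃ ℬ ∈ tableR, Equivalent 𝒜 ℬ)) →
      RefinedInertiallyArbitrary 𝒜 ∧ ¬ SpectrallyArbitrary 𝒜 := by
    intro h
    have key : (∀ e₁ e₂ e₃ e₄, RefinedAdmissible e₁ e₂ e₃ e₄ →
        quartic e₁ e₂ e₃ e₄ ∈ charpolySet 𝒜) ∧
        ∃ e₁ e₂ e₃ e₄, quartic e₁ e₂ e₃ e₄ ∉ charpolySet 𝒜 := by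
      rcases h with h | h | ⟨ℬ, hℬ, h⟩ <;> rw [h.charpolySet_eq]
      · exact ⟨fun _ _ _ _ => pathPattern_one_mem, _, _, _, _, quartic_not_mem_pathPattern_one⟩
      · exact ⟨fun _ _ _ _ => pathPattern_two_mem, _, _, _, _, quartic_not_mem_pathPattern_two⟩
      · exact ⟨fun _ _ _ _ => tableR_mem hℬ, exists_quartic_not_mem_tableR hℬ⟩
    exact ⟨(attainsRealWitnesses_of_RefinedAdmissible key.1).refinedInertiallyArbitrary
      (attainsImaginaryWitnesses_of_RefinedAdmissible key.1),
      not_spectrallyArbitrary_of_not_mem key.2⟩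
  have hB : (Equivalent 𝒜 (cyclePattern 4) ∨ (∃ ℬ ∈ tableB, Equivalent 𝒜 ℬ) ∨
      (∃ ℬ ∈ tableJ, Equivalent 𝒜 ℬ)) →
      InertiallyArbitrary 𝒜 ∧ ¬ RefinedInertiallyArbitrary 𝒜 := by
    intro h
    have key : (∀ e₁ e₂ e₃ e₄, InertialAdmissible e₁ e₂ e₃ e₄ →
        quartic e₁ e₂ e₃ e₄ ∈ charpolySet 𝒜) ∧
        ∀ e₂ e₄ : ℝ, 0 < e₂ → 0 < e₄ → quartic 0 e₂ 0 e₄ ∉ charpolySet 𝒜 := by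
      rcases h with h | ⟨ℬ, hℬ, h⟩ | ⟨ℬ, hℬ, h⟩ <;> rw [h.charpolySet_eq]
      · exact ⟨fun _ _ _ _ => cyclePattern_mem, fun _ _ h₂ _ => not_mem_cyclePattern h₂⟩
      · exact ⟨fun _ _ _ _ => tableB_mem hℬ, fun _ _ => not_mem_tableB hℬ⟩
      · exact ⟨fun _ _ _ _ => tableJ_mem hℬ, fun _ _ h₂ _ => not_mem_tableJ hℬ h₂⟩
    refine ⟨(attainsRealWitnesses_of_InertialAdmissible key.1).inertiallyArbitrary, fun hr => ?_⟩
    obtain ⟨e₂, e₄, h₂, h₄, hp⟩ := hr.exists_imaginary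
    exact key.2 e₂ e₄ h₂ h₄ hp
  have hSR : SpectrallyArbitrary 𝒜 → RefinedInertiallyArbitrary 𝒜 :=
    SpectrallyArbitrary.refinedInertiallyArbitrary
  have hRI : RefinedInertiallyArbitrary 𝒜 → InertiallyArbitrary 𝒜 :=
    RefinedInertiallyArbitrary.inertiallyArbitrary
  have hall : InertiallyArbitrary 𝒜 →
      ((∃ ℬ ∈ classCFour, Equivalent 𝒜 ℬ) ∨ (∃ ℬ ∈ classYFour, Equivalent 𝒜 ℬ)) ∨
      (Equivalent 𝒜 (pathPattern 4 1) ∨ Equivalent 𝒜 (pathPattern 4 2) ∨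
        (∃ ℬ ∈ tableR, Equivalent 𝒜 ℬ)) ∨
      (Equivalent 𝒜 (cyclePattern 4) ∨ (∃ ℬ ∈ tableB, Equivalent 𝒜 ℬ) ∨
        (∃ ℬ ∈ tableJ, Equivalent 𝒜 ℬ)) := by
    intro hi
    obtain ⟨ℬ, hℬ, h⟩ := exists_equivalent hirr hseven hi
    simp only [representatives, List.mem_cons, List.mem_append] at hℬ
    rcases hℬ with rfl | rfl | rfl | rfl | (((hℬ | hℬ) | hℬ) | hℬ) | hℬ
    · exact absurd hi (not_inertiallyArbitrary_of_equivalent_resonantPattern h)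
    · exact Or.inr (Or.inl (Or.inl h))
    · exact Or.inr (Or.inl (Or.inr (Or.inl h)))
    · exact Or.inr (Or.inr (Or.inl h))
    · exact Or.inl (Or.inl ⟨ℬ, hℬ, h⟩)
    · exact Or.inl (Or.inr ⟨ℬ, hℬ, h⟩)
    · exact Or.inr (Or.inl (Or.inr (Or.inr ⟨ℬ, hℬ, h⟩)))
    · exact Or.inr (Or.inr (Or.inr (Or.inl ⟨ℬ, hℬ, h⟩)))
    · exact Or.inr (Or.inr (Or.inr (Or.inr ⟨ℬ, hℬ, h⟩)))
  refine ⟨⟨fun h => ?_, hS⟩, ⟨fun h => ?_, hR⟩, ⟨fun h => ?_, hB⟩⟩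
  · rcases hall (hRI (hSR h)) with h' | h' | h'
    · exact h'
    · exact absurd h (hR h').2
    · exact absurd (hSR h) (hB h').2
  · rcases hall (hRI h.1) with h' | h' | h'
    · exact absurd (hS h') h.2
    · exact h'
    · exact absurd h.1 (hB h').2
  · rcases hall h.1 with h' | h' | h'
    · exact absurd (hSR (hS h')) h.2
    · exact absurd (hR h').1 h.2
    · exact h'
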